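/- Let $\alpha,\beta\in\mathbb{N}^n$ be multiindices, let $k,\ell\ge 0$ be integers, and let $\Phi,\Psi$ be smooth strictly positive functions on $\mathbb{C}^n$. Let $\chi_1,\chi_2$ be smooth (complex-valued) functions on $[0,\infty]$, where smoothness at $\infty$ means that $s\mapsto\chi_j(1/s)$ is smooth up to $s=0$. Assume that $\chi_1$ and $\chi_2$ vanish at $0$ to orders (at least) $k$ and $\ell$ respectively, and that $\chi_1(\infty)=1$. Let $\varphi$ be a smooth compactly supported complex-valued function on $\mathbb{C}^n$, identified with the test form $\varphi\,(i/2)^n d\zeta_1\wedge d\bar\zeta_1\wedge\cdots\wedge d\zeta_n\wedge d\bar\zeta_n$; all integrals over $\mathbb{C}^n$ are with respect to Lebesgue measure. For a multiindex $m$ the principal value current is $$\Big[\frac1{\zeta^m}\Big].\psi=\lim_{\delta\to0^+}\int_{|\zeta^m|^2>\delta}\frac{\psi}{\zeta^m}.$$ For $\epsilon_1,\epsilon_2>0$ put $$I(\epsilon_1,\epsilon_2)=\int_{\mathbb{C}^n}\frac1{\zeta^{k\alpha+\ell\beta}}\,\chi_1\big(\Phi|\zeta^\alpha|^2/\epsilon_1\big)\,\chi_2\big(\Psi|\zeta^\beta|^2/\epsilon_2\big)\,\varphi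 .$$ Then the integrand is integrable, all principal values below exist, and, as $\epsilon_1,\epsilon_2\to0^+$ independently, $$I(\epsilon_1,\epsilon_2)\to\Big[\frac1{\zeta^{k\alpha+\ell\beta}}\Big].\varphi\ \text{ if }\chi_2(\infty)=1,\qquad I(\epsilon_1,\epsilon_2)\to0\ \text{ if }\chi_2(\infty)=0 .$$ Moreover, extend $I$ to $[0,\infty)^2$ by setting, for $\epsilon_1,\epsilon_2>0$, $$I(\epsilon_1,0)=\chi_2(\infty)\Big[\frac1{\zeta^{\ell\beta}}\Big].\Big(\frac{\chi_1(\Phi|\zeta^\alpha|^2/\epsilon_1)}{\zeta^{k\alpha}}\varphi\Big),\qquad I(0,\epsilon_2)=\Big[\frac1{\zeta^{k\alpha}}\Big].\Big(\frac{\chi_2(\Psi|\zeta^\beta|^2/\epsilon_2)}{\zeta^{\ell\beta}}\varphi\Big),$$ $$I(0,0)=\chi_2(\infty)\Big[\frac1{\zeta^{k\alpha+\ell\beta}}\Big].\varphi .$$ Then for every $\omega\in(0,1]$ with $2\omega<\min\{|\alpha|^{-1},|\beta|^{-1}\}$ the function $I$ is $\omega$-Hölder continuous on $[0,\infty)^2$.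 Here $|\alpha|=(\sum_j\alpha_j^2)^{1/2}$ is the Euclidean length, and $|0|^{-1}=\infty$. -/

import Mathlib

open MeasureTheory Filter Topology Set
open scoped ENNReal NNReal ContDiff

/-- A function on the closed half-line `[0,∞]` is smooth: it is smooth on `[0,∞)` (one-sided
derivatives at `0`), and `s ↦ χ (1 / s)` is smooth on `[0,∞)`, where `1 / 0 = ∞`. -/
def SmoothOnExtended (χ : ℝ≥0∞ → ℂ) : Prop :=
  ContDiffOn ℝ ∞ (fun t : ℝ => χ (ENNReal.ofReal t)) (Ici 0) ∧
    ContDiffOn ℝ ∞ (fun s : ℝ => χ ((ENNReal.ofReal s)⁻¹)) (Ici 0)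

/-- `χ` vanishes to order (at least) `k` at `0`: the derivatives of order `0, …, k - 1` at `0`
are zero. -/
def VanishesToOrderAtZero (χ : ℝ≥0∞ → ℂ) (k : ℕ) : Prop :=
  ∀ j < k, iteratedDerivWithin j (fun t : ℝ => χ (ENNReal.ofReal t)) (Ici 0) 0 = 0

/-- The monomial `ζ ^ m = ∏ ζ_j ^ m_j`. -/
noncomputable def cMonomial {n : ℕ} (m : Fin n → ℕ) (ζ : Fin n → ℂ) : ℂ :=
  ∏ j, ζ j ^ m j

/-- The Euclidean length of a multiindex. -/
noncomputable def multiindexLength {n : ℕ} (m : Fin n → ℕ) : ℝ :=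
  Real.sqrt (∑ j, (m j : ℝ) ^ 2)

/-- The truncated integral of `φ / ζ ^ m` over `{|ζ ^ m|² > δ}`. Integration over `ℂⁿ` is with
respect to Lebesgue measure, the volume form `(i/2)ⁿ dζ ∧ dζ̄`. -/
noncomputable def truncatedIntegral {n : ℕ} (m : Fin n → ℕ) (φ : (Fin n → ℂ) → ℂ) (δ : ℝ) : ℂ :=
  ∫ ζ in {ζ : Fin n → ℂ | δ < ‖cMonomial m ζ‖ ^ 2}, φ ζ / cMonomial m ζ

/-- The limit defining the principal value `[1 / ζ ^ m] . φ` exists. -/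
def PrincipalValueExists {n : ℕ} (m : Fin n → ℕ) (φ : (Fin n → ℂ) → ℂ) : Prop :=
  ∃ L : ℂ, Tendsto (truncatedIntegral m φ) (𝓝[>] 0) (𝓝 L)

/-- The principal value current `[1 / ζ ^ m]` acting on `φ`. -/
noncomputable def principalValue {n : ℕ} (m : Fin n → ℕ) (φ : (Fin n → ℂ) → ℂ) : ℂ :=
  limUnder (𝓝[>] 0) (truncatedIntegral m φ)

/-- The function `ζ ↦ χ (Φ |ζ ^ α|² / ε)`, for `ε > 0`. -/
noncomputable def cutoff {n : ℕ} (χ : ℝ≥0∞ → ℂ) (Φ : (Fin n → ℂ) → ℝ) (α : Fin n → ℕ) (ε : ℝ)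
    (ζ : Fin n → ℂ) : ℂ :=
  χ (ENNReal.ofReal (Φ ζ * ‖cMonomial α ζ‖ ^ 2 / ε))

/-- The integrand `ζ ^ {-(kα+ℓβ)} χ₁(Φ|ζ^α|²/ε₁) χ₂(Ψ|ζ^β|²/ε₂) φ`, for `ε₁, ε₂ > 0`. -/
noncomputable def regIntegrand {n : ℕ} (χ₁ χ₂ : ℝ≥0∞ → ℂ) (Φ Ψ : (Fin n → ℂ) → ℝ)
    (α β : Fin n → ℕ) (k ℓ : ℕ) (φ : (Fin n → ℂ) → ℂ) (ε : ℝ × ℝ) (ζ : Fin n → ℂ) : ℂ :=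
  1 / cMonomial (k • α + ℓ • β) ζ * cutoff χ₁ Φ α ε.1 ζ * cutoff χ₂ Ψ β ε.2 ζ * φ ζ

/-- The regularized integral as a function on `[0,∞)²`. On the open quadrant it is the integral;
on the axes one factor is replaced by its value at `∞` and the corresponding negative power by
the principal value current, acting on the (smooth) product of the remaining factors; at the
origin both are. -/
noncomputable def regIntegral {n : ℕ} (χ₁ χ₂ : ℝ≥0∞ → ℂ) (Φ Ψ : (Fin n → ℂ) → ℝ)
    (α β : Fin n → ℕ) (k ℓ : ℕ) (φ : (Fin n → ℂ) → ℂ) (ε : ℝ × ℝ) : ℂ :=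
  if 0 < ε.1 then
    if 0 < ε.2 then ∫ ζ, regIntegrand χ₁ χ₂ Φ Ψ α β k ℓ φ ε ζ
    else χ₂ ⊤ * principalValue (ℓ • β) (fun ζ => cutoff χ₁ Φ α ε.1 ζ / cMonomial (k • α) ζ * φ ζ)
  else
    if 0 < ε.2 then
      χ₁ ⊤ * principalValue (k • α) (fun ζ => cutoff χ₂ Ψ β ε.2 ζ / cMonomial (ℓ • β) ζ * φ ζ)
    else χ₁ ⊤ * χ₂ ⊤ * principalValue (k • α + ℓ • β) φ

/-!
Write `m = k α + ℓ β`. The singularity of `1 / ζ ^ m` is not absolutely integrable, but all other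
singular ingredients, namely `|ζ ^ α|²`, `|ζ ^ β|²` and the truncations `|ζ ^ m'|² > δ`, are
invariant under the rotations `ζ ↦ (u_1 ζ_1, …, u_n ζ_n)`, `|u_j| = 1`. Hence every integral of
`F / ζ ^ m` that occurs is unchanged (`setIntegral_torusAverage`) if `F` is replaced by its
component of weight `m`, the average of `u ^ (-m) F(u ζ)` over rotations. Finitely many rotations,
by `N`-th roots of unity with `N ≥ 2 m_j` for all `j`, are enough.

For a smooth `f`, the component of weight `m` is divisible by `ζ ^ m`: its modulus is at most a
constant times `|ζ ^ m|` times a bound for the derivatives of `f` of order `∑ m_j`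
(`norm_torusAverage_le`). This is a Taylor expansion in disguise: in one variable the monomials
`ζ ^ a ζ̄ ^ b` with `a + b < m` have weight `a - b ≠ m`.

In the numerator of the regularized integral, the quantities `s₁ = ε₁ / |ζ ^ α|²` and
`s₂ = ε₂ / |ζ ^ β|²` do not change under rotation, so the estimate applies to
`w ↦ χ₁(Φ(w) / s₁) χ₂(Ψ(w) / s₂) φ(w)` for fixed `s₁, s₂ ≥ 0`, where `s = 0` stands for the value of
`χ` at infinity. With `h(s) = χ(1/s)`, one has `χ(Φ / s) = h(s e^x)` for `x = -log Φ`, whose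
`x`-derivatives are the iterated Euler derivatives `(s d/ds)^i h`. As `χ` is smooth at both `0` and
`∞`, these are bounded and Lipschitz on `[0,∞)` (`SmoothPair.exists_bound`,
`SmoothPair.exists_lipschitz`). So the averaged integrand is bounded, and Lipschitz in `(s₁, s₂)`;
interpolating the two bounds, it is Hölder continuous of exponent `ω` in `(ε₁, ε₂)` with the
constant `C (|ζ ^ α| ^ (-2ω) + |ζ ^ β| ^ (-2ω))`, which is locally integrable
(`exists_averagedIntegral_sub_le`).

The averaged integrals converge absolutely down to `ε₁ = 0` and `ε₂ = 0`, where dominated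
convergence identifies them with the principal values (`tendsto_truncatedIntegral`). The vanishing
of `χ₁` and `χ₂` at `0` only serves to make the integrals before averaging converge. The limits at
the origin are a case of the Hölder continuity.
-/

/-! ### Averages over finite tori of rotations -/

noncomputable instance rootsOfUnityFintype (N : ℕ) [NeZero N] : Fintype (rootsOfUnity N ℂ) :=
  Fintype.ofFinite _

/-- The diagonal rotation `ζ ↦ (u_1 ζ_1, …, u_n ζ_n)` of `ℂⁿ` by `N`-th roots of unity. -/
def torusRotate {n N : ℕ} (u : Fin n → rootsOfUnity N ℂ) (ζ : Fin n → ℂ) : Fin n → ℂ :=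
  fun j => ((u j : ℂˣ) : ℂ) * ζ j

/-- The character `u ↦ u ^ (-M)` of the finite torus of `N`-th roots of unity. -/
noncomputable def torusWeight {n N : ℕ} (M : Fin n → ℤ) (u : Fin n → rootsOfUnity N ℂ) : ℂ :=
  ∏ j, ((u j : ℂˣ) : ℂ) ^ (-M j)

/-- The component of `f` of weight `M` under the finite torus of diagonal rotations by `N`-th
roots of unity: the average of `u ^ (-M) f(u ζ)` over `u`. With finitely many rotations it is a
finite sum, and only the class of `M` modulo `N` matters. -/
noncomputable def torusAverage {n : ℕ} (N : ℕ) [NeZero N] (M : Fin n → ℤ) (f : (Fin n → ℂ) → ℂ)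
    (ζ : Fin n → ℂ) : ℂ :=
  (Fintype.card (Fin n → rootsOfUnity N ℂ) : ℂ)⁻¹ *
    ∑ u : Fin n → rootsOfUnity N ℂ, torusWeight M u * f (torusRotate u ζ)

section Torus

variable {n N : ℕ}

lemma norm_coe_rootsOfUnity [NeZero N] (u : rootsOfUnity N ℂ) : ‖((u : ℂˣ) : ℂ)‖ = 1 :=
  Complex.norm_eq_one_of_mem_rootsOfUnity u.2

lemma norm_torusWeight [NeZero N] (M : Fin n → ℤ) (u : Fin n → rootsOfUnity N ℂ) :
    ‖torusWeight M u‖ = 1 := by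
  simp [torusWeight, norm_prod, norm_zpow, norm_coe_rootsOfUnity]

lemma norm_torusRotate_apply [NeZero N] (u : Fin n → rootsOfUnity N ℂ) (ζ : Fin n → ℂ)
    (j : Fin n) : ‖torusRotate u ζ j‖ = ‖ζ j‖ := by
  simp [torusRotate, norm_coe_rootsOfUnity]

lemma norm_torusRotate [NeZero N] (u : Fin n → rootsOfUnity N ℂ) (ζ : Fin n → ℂ) :
    ‖torusRotate u ζ‖ = ‖ζ‖ := by
  rw [Pi.norm_def, Pi.norm_def]
  congr 2
  funext j
  exact NNReal.eq (norm_torusRotate_apply u ζ j)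

lemma norm_torusAverage_le_of_forall [NeZero N] (M : Fin n → ℤ) (f : (Fin n → ℂ) → ℂ)
    (ζ : Fin n → ℂ) {B : ℝ} (h : ∀ u : Fin n → rootsOfUnity N ℂ, ‖f (torusRotate u ζ)‖ ≤ B) :
    ‖torusAverage N M f ζ‖ ≤ B := by
  have hc : (0 : ℝ) < Fintype.card (Fin n → rootsOfUnity N ℂ) := by
    exact_mod_cast Fintype.card_pos
  rw [torusAverage, norm_mul, norm_inv, Complex.norm_natCast, inv_mul_le_iff₀ hc]
  refine (norm_sum_le _ _).trans ?_
  refine (Finset.sum_le_card_nsmul _ _ B fun u _ => ?_).trans ?_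
  · rw [norm_mul, norm_torusWeight, one_mul]; exact h u
  · simp

lemma torusAverage_sub [NeZero N] (M : Fin n → ℤ) (f g : (Fin n → ℂ) → ℂ) (ζ : Fin n → ℂ) :
    torusAverage N M (fun w => f w - g w) ζ = torusAverage N M f ζ - torusAverage N M g ζ := by
  simp only [torusAverage, mul_sub, Finset.sum_sub_distrib]

lemma torusAverage_const_mul [NeZero N] (M : Fin n → ℤ) (c : ℂ) (f : (Fin n → ℂ) → ℂ)
    (ζ : Fin n → ℂ) :
    torusAverage N M (fun w => c * f w) ζ = c * torusAverage N M f ζ := by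
  simp only [torusAverage, Finset.mul_sum]
  refine Finset.sum_congr rfl fun u _ => by ring

lemma torusAverage_congr [NeZero N] (M : Fin n → ℤ) {f g : (Fin n → ℂ) → ℂ} {ζ : Fin n → ℂ}
    (h : ∀ u : Fin n → rootsOfUnity N ℂ, f (torusRotate u ζ) = g (torusRotate u ζ)) :
    torusAverage N M f ζ = torusAverage N M g ζ := by
  simp only [torusAverage, h]

/-- A nontrivial weight in the `j`-th variable forces the average to vanish where `ζ j = 0`, since
rotating that variable does nothing there. -/
lemma torusAverage_eq_zero [NeZero N] (M : Fin n → ℤ) (f : (Fin n → ℂ) → ℂ) (ζ : Fin n → ℂ)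
    (j : Fin n) (hj : ζ j = 0) (h0 : 0 < M j) (hN : M j < N) : torusAverage N M f ζ = 0 := by
  classical
  have hprim := Complex.isPrimitiveRoot_exp N (NeZero.ne N)
  set g : rootsOfUnity N ℂ := hprim.toRootsOfUnity with hg
  have hgM : ((g : ℂˣ) : ℂ) ^ (-M j) ≠ 1 := by
    intro h
    have h' : ((g : ℂˣ) : ℂ) = Complex.exp (2 * Real.pi * Complex.I / N) := by simp [hg]
    rw [h', hprim.zpow_eq_one_iff_dvd, dvd_neg] at h
    exact absurd (Int.le_of_dvd h0 h) (not_le.mpr hN)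
  set S := ∑ u : Fin n → rootsOfUnity N ℂ, torusWeight M u * f (torusRotate u ζ) with hS
  -- The substitution `u ↦ g u`, with `g` a primitive root in the `j`-th place, multiplies the sum
  -- by a nontrivial root of unity and leaves the values of `f` unchanged.
  have key : S = ((g : ℂˣ) : ℂ) ^ (-M j) * S := by
    rw [hS, Finset.mul_sum, ← Equiv.sum_comp (Equiv.mulLeft (Pi.mulSingle j g))]
    refine Finset.sum_congr rfl fun u _ => ?_
    have h1 : torusRotate (Pi.mulSingle j g * u) ζ = torusRotate u ζ := by
      funext i
      by_cases hij : i = j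
      · subst hij; simp [torusRotate, hj]
      · simp [torusRotate, Pi.mulSingle_eq_of_ne hij]
    have h2 : torusWeight M (Pi.mulSingle j g * u) = ((g : ℂˣ) : ℂ) ^ (-M j) * torusWeight M u := by
      simp only [torusWeight, Pi.mul_apply, Subgroup.coe_mul, Units.val_mul, mul_zpow,
        Finset.prod_mul_distrib]
      congr 1
      rw [Finset.prod_eq_single j]
      · simp
      · intro i _ hij; simp [Pi.mulSingle_eq_of_ne hij]
      · simp
    rw [Equiv.coe_mulLeft, h1, h2, mul_assoc]
  have : S = 0 := by
    by_contra h
    exact hgM (mul_right_cancel₀ h (by rw [one_mul]; exact key.symm))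
  rw [torusAverage, ← hS, this, mul_zero]

/-- The first order operator `(∂/∂x_j + c ∂/∂y_j) / 2` on functions of `ζ_j = x_j + i y_j`: the
Wirtinger derivatives are the cases `c = -i` and `c = i`. -/
noncomputable def wirtinger (j : Fin n) (c : ℂ) (f : (Fin n → ℂ) → ℂ) (w : Fin n → ℂ) : ℂ :=
  (1 / 2) * (fderiv ℝ f w (Pi.single j 1) + c * fderiv ℝ f w (Pi.single j Complex.I))

/-- `wirtinger j c` as a continuous linear functional of the total derivative. -/
noncomputable def wirtingerCLM (j : Fin n) (c : ℂ) : ((Fin n → ℂ) →L[ℝ] ℂ) →L[ℝ] ℂ :=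
  ((1 / 2 : ℂ)) • (ContinuousLinearMap.apply ℝ ℂ (Pi.single j (1 : ℂ)) +
    c • ContinuousLinearMap.apply ℝ ℂ (Pi.single j Complex.I))

lemma wirtinger_eq (j : Fin n) (c : ℂ) (f : (Fin n → ℂ) → ℂ) :
    wirtinger j c f = wirtingerCLM j c ∘ fderiv ℝ f := by
  funext w
  simp [wirtinger, wirtingerCLM, mul_add]

lemma norm_wirtingerCLM_le (j : Fin n) {c : ℂ} (hc : ‖c‖ = 1) : ‖wirtingerCLM j c‖ ≤ 1 := by
  refine ContinuousLinearMap.opNorm_le_bound _ zero_le_one fun T => ?_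
  have h1 : ‖T (Pi.single j 1)‖ ≤ ‖T‖ := by
    simpa [Pi.norm_single] using T.le_opNorm (Pi.single j (1 : ℂ))
  have h2 : ‖T (Pi.single j Complex.I)‖ ≤ ‖T‖ := by
    simpa [Pi.norm_single] using T.le_opNorm (Pi.single j Complex.I)
  have : wirtingerCLM j c T =
      (1 / 2) * (T (Pi.single j 1) + c * T (Pi.single j Complex.I)) := by
    simp [wirtingerCLM, mul_add]
  rw [this, norm_mul]
  have h3 := norm_add_le (T (Pi.single j 1)) (c * T (Pi.single j Complex.I))
  rw [norm_mul, hc] at h3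
  have : ‖(1 / 2 : ℂ)‖ = 1 / 2 := by norm_num
  rw [this]
  linarith

lemma contDiff_wirtinger (j : Fin n) (c : ℂ) {f : (Fin n → ℂ) → ℂ} (hf : ContDiff ℝ ∞ f) :
    ContDiff ℝ ∞ (wirtinger j c f) := by
  rw [wirtinger_eq]
  exact (wirtingerCLM j c).contDiff.comp (hf.fderiv_right (by simp))

lemma norm_iteratedFDeriv_wirtinger_le (j : Fin n) {c : ℂ} (hc : ‖c‖ = 1)
    {f : (Fin n → ℂ) → ℂ} (hf : ContDiff ℝ ∞ f) (d : ℕ) (w : Fin n → ℂ) :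
    ‖iteratedFDeriv ℝ d (wirtinger j c f) w‖ ≤ ‖iteratedFDeriv ℝ (d + 1) f w‖ := by
  rw [wirtinger_eq, ← norm_iteratedFDeriv_fderiv]
  refine ((wirtingerCLM j c).norm_iteratedFDeriv_comp_left
    (hf.fderiv_right (m := ∞) (by simp)).contDiffAt (by exact_mod_cast le_top)).trans ?_
  exact mul_le_of_le_one_left (norm_nonneg _) (norm_wirtingerCLM_le j hc)

lemma fderiv_single_eq_wirtinger (j : Fin n) (f : (Fin n → ℂ) → ℂ) (w : Fin n → ℂ) (z : ℂ) :
    fderiv ℝ f w (Pi.single j z) =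
      z * wirtinger j (-Complex.I) f w + star z * wirtinger j Complex.I f w := by
  have hz : (Pi.single j z : Fin n → ℂ) =
      z.re • (Pi.single j (1 : ℂ) : Fin n → ℂ) + z.im • (Pi.single j Complex.I : Fin n → ℂ) := by
    rw [← Pi.single_smul, ← Pi.single_smul, ← Pi.single_add]
    congr 1
    apply Complex.ext <;> simp
  rw [hz, map_add, map_smul, map_smul, wirtinger, wirtinger]
  set a := fderiv ℝ f w (Pi.single j 1)
  set b := fderiv ℝ f w (Pi.single j Complex.I)
  have h1 : z = z.re + z.im * Complex.I := (Complex.re_add_im z).symm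
  have h2 : star z = z.re - z.im * Complex.I := by
    apply Complex.ext <;> simp
  rw [h2]
  nth_rewrite 3 [h1]
  simp only [Complex.real_smul]
  ring_nf
  rw [Complex.I_sq]
  ring

/-- Rotating after scaling the `j`-th coordinate by `s`: the derivative in `s`, written with
Wirtinger derivatives. -/
lemma hasDerivAt_comp_torusRotate_update (u : Fin n → rootsOfUnity N ℂ) (ζ : Fin n → ℂ)
    (j : Fin n) {f : (Fin n → ℂ) → ℂ} (hf : ContDiff ℝ ∞ f) (s : ℝ) :
    HasDerivAt (fun s : ℝ => f (torusRotate u (Function.update ζ j (s * ζ j))))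
      ((((u j : ℂˣ) : ℂ) * ζ j) * wirtinger j (-Complex.I) f
          (torusRotate u (Function.update ζ j (s * ζ j))) +
        star (((u j : ℂˣ) : ℂ) * ζ j) * wirtinger j Complex.I f
          (torusRotate u (Function.update ζ j (s * ζ j)))) s := by
  rw [← fderiv_single_eq_wirtinger]
  have hpath : HasDerivAt (fun s : ℝ => torusRotate u (Function.update ζ j (s * ζ j)))
      (Pi.single j (((u j : ℂˣ) : ℂ) * ζ j)) s := by
    rw [hasDerivAt_pi]
    intro i
    by_cases hij : i = j
    · subst hij
      simp only [torusRotate, Function.update_self, Pi.single_eq_same]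
      have h1 : HasDerivAt (fun s : ℝ => (s : ℂ)) 1 s := Complex.ofRealCLM.hasDerivAt
      simpa using (h1.mul_const (ζ i)).const_mul ((u i : ℂˣ) : ℂ)
    · simp only [torusRotate, Function.update_of_ne hij, Pi.single_eq_of_ne hij]
      exact hasDerivAt_const _ _
  exact ((hf.differentiable (by simp)).differentiableAt.hasFDerivAt).comp_hasDerivAt s hpath

lemma torusWeight_mul_coe (M : Fin n → ℤ) (u : Fin n → rootsOfUnity N ℂ) (j : Fin n) (e : ℤ) :
    torusWeight M u * ((u j : ℂˣ) : ℂ) ^ e = torusWeight (M - Pi.single j e) u := by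
  classical
  have h : ((u j : ℂˣ) : ℂ) ^ e = ∏ i, ((u i : ℂˣ) : ℂ) ^ ((Pi.single j e : Fin n → ℤ) i) := by
    rw [Finset.prod_eq_single j]
    · simp
    · intro i _ hij; simp [Pi.single_eq_of_ne hij]
    · simp
  rw [h, torusWeight, torusWeight, ← Finset.prod_mul_distrib]
  refine Finset.prod_congr rfl fun i _ => ?_
  rw [← zpow_add₀ (Units.ne_zero _)]
  congr 1
  simp only [Pi.sub_apply]
  ring

lemma hasDerivAt_torusAverage_update [NeZero N] (M : Fin n → ℤ) (ζ : Fin n → ℂ)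
    (j : Fin n) {f : (Fin n → ℂ) → ℂ} (hf : ContDiff ℝ ∞ f) (s : ℝ) :
    HasDerivAt (fun s : ℝ => torusAverage N M f (Function.update ζ j (s * ζ j)))
      (ζ j * torusAverage N (M - Pi.single j 1) (wirtinger j (-Complex.I) f)
          (Function.update ζ j (s * ζ j)) +
        star (ζ j) * torusAverage N (M - Pi.single j (-1)) (wirtinger j Complex.I f)
          (Function.update ζ j (s * ζ j))) s := by
  have h := (HasDerivAt.fun_sum (u := Finset.univ)
    fun (u : Fin n → rootsOfUnity N ℂ) _ =>
      (hasDerivAt_comp_torusRotate_update u ζ j hf s).const_mul (torusWeight M u)).const_mul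
        (Fintype.card (Fin n → rootsOfUnity N ℂ) : ℂ)⁻¹
  refine h.congr_deriv ?_
  simp only [torusAverage, ← torusWeight_mul_coe]
  rw [mul_left_comm, mul_left_comm (star (ζ j)), ← mul_add]
  congr 1
  rw [Finset.mul_sum, Finset.mul_sum, ← Finset.sum_add_distrib]
  refine Finset.sum_congr rfl fun u _ => ?_
  have hstar : star (((u j : ℂˣ) : ℂ)) = (((u j : ℂˣ) : ℂ)) ^ (-1 : ℤ) := by
    rw [zpow_neg_one, Complex.inv_eq_conj (norm_coe_rootsOfUnity (u j))]
    rfl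
  rw [star_mul', hstar, zpow_one]
  ring

/-- The component of weight `M` of a smooth function vanishes along the coordinate hyperplanes to
the orders `p ≤ M`, with a bound by the derivatives of order `|p|`. The mean value inequality on
the segment that scales `ζ j` to zero gains one factor `ζ j` for one derivative; it applies as
long as the weight in that variable is nonzero modulo `N`, which is what `M j + p j ≤ N`
guarantees throughout. -/
theorem norm_torusAverage_le [NeZero N] (R : ℝ) (d : ℕ) (p : Fin n → ℕ) (hp : ∑ j, p j = d)
    (M : Fin n → ℤ) (hpM : ∀ j, (p j : ℤ) ≤ M j) (hMN : ∀ j, M j + p j ≤ N)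
    {f : (Fin n → ℂ) → ℂ} (hf : ContDiff ℝ ∞ f) {B : ℝ}
    (hB : ∀ w, ‖w‖ ≤ R → ‖iteratedFDeriv ℝ d f w‖ ≤ B) (ζ : Fin n → ℂ) (hζ : ‖ζ‖ ≤ R) :
    ‖torusAverage N M f ζ‖ ≤ 2 ^ d * B * ∏ j, ‖ζ j‖ ^ p j := by
  classical
  induction d generalizing p M f ζ with
  | zero =>
    have hp0 : ∀ j, p j = 0 := by simpa using hp
    simp only [hp0, pow_zero, Finset.prod_const_one, mul_one, one_mul]
    refine norm_torusAverage_le_of_forall M f ζ fun u => ?_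
    simpa using hB (torusRotate u ζ) ((norm_torusRotate u ζ).trans_le hζ)
  | succ d ih =>
    obtain ⟨j, hj⟩ : ∃ j, p j ≠ 0 := by
      by_contra h
      push Not at h
      simp [h] at hp
    have hB0 : 0 ≤ B := (norm_nonneg _).trans (hB ζ hζ)
    obtain ⟨q, hq⟩ : ∃ q, q = Function.update p j (p j - 1) := ⟨_, rfl⟩
    have hqj : q j + 1 = p j := by rw [hq, Function.update_self]; omega
    have hqi : ∀ i, i ≠ j → q i = p i := fun i hi => by rw [hq, Function.update_of_ne hi]
    have hpq : p = q + Pi.single j 1 := by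
      funext i
      by_cases hi : i = j
      · subst hi; simp [hqj]
      · simp [hi, hqi i hi]
    have hqsum : ∑ i, q i = d := by
      rw [hpq] at hp
      simp only [Pi.add_apply, Finset.sum_add_distrib, Finset.sum_pi_single', Finset.mem_univ,
        if_true] at hp
      omega
    have hupd : ∀ s ∈ Icc (0 : ℝ) 1, ∀ i, ‖Function.update ζ j (s * ζ j) i‖ ≤ ‖ζ i‖ := by
      intro s hs i
      by_cases hi : i = j
      · subst hi
        rw [Function.update_self, norm_mul, Complex.norm_real, Real.norm_of_nonneg hs.1]
        exact mul_le_of_le_one_left (norm_nonneg _) hs.2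
      · rw [Function.update_of_ne hi]
    have hprod : ∏ i, ‖ζ i‖ ^ p i = ‖ζ j‖ * ∏ i, ‖ζ i‖ ^ q i := by
      rw [hpq]
      simp only [Pi.add_apply, pow_add, Finset.prod_mul_distrib]
      rw [mul_comm]
      congr 1
      rw [Finset.prod_eq_single j]
      · simp
      · intro i _ hij; simp [hij]
      · simp
    have step : ∀ (e : ℤ) (c : ℂ), (e = 1 ∨ e = -1) → ‖c‖ = 1 → ∀ s ∈ Icc (0 : ℝ) 1,
        ‖torusAverage N (M - Pi.single j e) (wirtinger j c f) (Function.update ζ j (s * ζ j))‖ ≤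
          2 ^ d * B * ∏ i, ‖ζ i‖ ^ q i := by
      intro e c he hc s hs
      have hR : 0 ≤ R := (norm_nonneg _).trans hζ
      have hf' := contDiff_wirtinger j c hf
      have h1 : ∀ i, (q i : ℤ) ≤ (M - Pi.single j e : Fin n → ℤ) i := by
        intro i
        by_cases hi : i = j
        · subst hi
          have := hpM i
          simp only [Pi.sub_apply, Pi.single_eq_same]
          rcases he with rfl | rfl <;> omega
        · simpa [hi, hqi i hi] using hpM i
      have h2 : ∀ i, (M - Pi.single j e : Fin n → ℤ) i + q i ≤ N := by
        intro i
        by_cases hi : i = j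
        · subst hi
          have := hMN i
          simp only [Pi.sub_apply, Pi.single_eq_same]
          rcases he with rfl | rfl <;> omega
        · simpa [hi, hqi i hi] using hMN i
      have h3 : ∀ w, ‖w‖ ≤ R → ‖iteratedFDeriv ℝ d (wirtinger j c f) w‖ ≤ B := fun w hw =>
        (norm_iteratedFDeriv_wirtinger_le j hc hf d w).trans (hB w hw)
      have h4 : ‖Function.update ζ j (s * ζ j)‖ ≤ R :=
        (pi_norm_le_iff_of_nonneg hR).2 fun i =>
          (hupd s hs i).trans ((norm_le_pi_norm ζ i).trans hζ)
      have h5 := ih q hqsum _ h1 h2 hf' h3 _ h4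
      refine h5.trans ?_
      gcongr with i
      exact hupd s hs i
    have hder : ∀ s ∈ Icc (0 : ℝ) 1,
        ‖ζ j * torusAverage N (M - Pi.single j 1) (wirtinger j (-Complex.I) f)
            (Function.update ζ j (s * ζ j)) +
          star (ζ j) * torusAverage N (M - Pi.single j (-1)) (wirtinger j Complex.I f)
            (Function.update ζ j (s * ζ j))‖ ≤ 2 ^ (d + 1) * B * ∏ i, ‖ζ i‖ ^ p i := by
      intro s hs
      have h1 := step 1 (-Complex.I) (Or.inl rfl) (by simp) s hs
      have h2 := step (-1) Complex.I (Or.inr rfl) (by simp) s hs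
      refine (norm_add_le _ _).trans ?_
      rw [norm_mul, norm_mul, norm_star]
      have h3 := mul_le_mul_of_nonneg_left h1 (norm_nonneg (ζ j))
      have h4 := mul_le_mul_of_nonneg_left h2 (norm_nonneg (ζ j))
      rw [hprod, pow_succ]
      linarith
    have hmv := norm_image_sub_le_of_norm_deriv_le_segment_01'
      (fun s _ => (hasDerivAt_torusAverage_update (N := N) M ζ j hf s).hasDerivWithinAt)
      (fun s hs => hder s ⟨hs.1, hs.2.le⟩)
    have hzero : torusAverage N M f (Function.update ζ j (((0 : ℝ) : ℂ) * ζ j)) = 0 := by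
      have h1 := hpM j
      have h2 := hMN j
      exact torusAverage_eq_zero M f _ j (by simp) (by omega) (by omega)
    rw [hzero, sub_zero] at hmv
    simpa using hmv

end Torus

/-! ### The Euler derivative of functions on the extended half-line -/

/-- The Euler derivative `h ↦ s h'(s)` on the half-line `[0,∞)`. -/
noncomputable def eulerDeriv (h : ℝ → ℂ) (s : ℝ) : ℂ :=
  (s : ℂ) * derivWithin h (Ici 0) s

lemma contDiffOn_eulerDeriv {h : ℝ → ℂ} (hh : ContDiffOn ℝ ∞ h (Ici 0)) :
    ContDiffOn ℝ ∞ (eulerDeriv h) (Ici 0) :=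
  Complex.ofRealCLM.contDiff.contDiffOn.mul (hh.derivWithin (uniqueDiffOn_Ici 0) (by simp))

lemma contDiffOn_iterate_eulerDeriv {h : ℝ → ℂ} (hh : ContDiffOn ℝ ∞ h (Ici 0)) (i : ℕ) :
    ContDiffOn ℝ ∞ (eulerDeriv^[i] h) (Ici 0) := by
  induction i with
  | zero => exact hh
  | succ i ih => rw [Function.iterate_succ_apply']; exact contDiffOn_eulerDeriv ih

lemma hasDerivWithinAt_Ici {h : ℝ → ℂ} (hh : ContDiffOn ℝ ∞ h (Ici 0)) {s : ℝ} (hs : 0 ≤ s) :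
    HasDerivWithinAt h (derivWithin h (Ici 0) s) (Ici 0) s :=
  ((hh.differentiableOn (by simp)) s hs).hasDerivWithinAt

/-- The inversion `s ↦ 1/s` turns the Euler derivative into its negative. -/
lemma eulerDeriv_inv {h k : ℝ → ℂ} (hk : ContDiffOn ℝ ∞ k (Ici 0)) {c : ℂ}
    (hc : ∀ s, 0 < s → h s = c * k s⁻¹) {s : ℝ} (hs : 0 < s) :
    eulerDeriv h s = -c * eulerDeriv k s⁻¹ := by
  have hs' : 0 < s⁻¹ := inv_pos.2 hs
  have h1 : HasDerivAt k (derivWithin k (Ici 0) s⁻¹) s⁻¹ :=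
    (hasDerivWithinAt_Ici hk hs'.le).hasDerivAt (Ici_mem_nhds hs')
  have h2 : HasDerivAt (fun s => c * k s⁻¹)
      (c * ((-(s ^ 2)⁻¹ : ℝ) • derivWithin k (Ici 0) s⁻¹)) s :=
    (HasDerivAt.scomp s h1 (hasDerivAt_inv hs.ne')).const_mul c
  have h3 : HasDerivAt h (c * ((-(s ^ 2)⁻¹ : ℝ) • derivWithin k (Ici 0) s⁻¹)) s :=
    h2.congr_of_eventuallyEq (by filter_upwards [lt_mem_nhds hs] with t ht using hc t ht)
  have hsC : (s : ℂ) ≠ 0 := by exact_mod_cast hs.ne'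
  rw [eulerDeriv, h3.hasDerivWithinAt.derivWithin ((uniqueDiffOn_Ici 0) s hs.le), eulerDeriv,
    Complex.real_smul]
  push_cast
  field_simp

/-- A function on `[0,∞)` that is smooth up to `0` and up to `∞`: the two charts `h` and `k` of the
extended half-line are glued along `s ↦ 1/s`. -/
structure SmoothPair (h k : ℝ → ℂ) : Prop where
  left : ContDiffOn ℝ ∞ h (Ici 0)
  right : ContDiffOn ℝ ∞ k (Ici 0)
  glue : ∀ s, 0 < s → h s = k s⁻¹

namespace SmoothPair

variable {h k : ℝ → ℂ}

lemma iterate_eulerDeriv_eq (H : SmoothPair h k) (i : ℕ) {s : ℝ} (hs : 0 < s) :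
    eulerDeriv^[i] h s = (-1) ^ i * eulerDeriv^[i] k s⁻¹ := by
  induction i generalizing s with
  | zero => simpa using H.glue s hs
  | succ i ih =>
    rw [Function.iterate_succ_apply', Function.iterate_succ_apply',
      eulerDeriv_inv (contDiffOn_iterate_eulerDeriv H.right i) (fun s hs => ih hs) hs, pow_succ]
    ring

/-- All iterated Euler derivatives of a function smooth up to `0` and `∞` are bounded. -/
lemma exists_bound (H : SmoothPair h k) (i : ℕ) :
    ∃ C, ∀ s, 0 ≤ s → ‖eulerDeriv^[i] h s‖ ≤ C := by
  obtain ⟨C₁, h₁⟩ := (isCompact_Icc (a := (0 : ℝ)) (b := 1)).exists_bound_of_continuousOn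
    ((contDiffOn_iterate_eulerDeriv H.left i).continuousOn.mono fun x hx => hx.1)
  obtain ⟨C₂, h₂⟩ := (isCompact_Icc (a := (0 : ℝ)) (b := 1)).exists_bound_of_continuousOn
    ((contDiffOn_iterate_eulerDeriv H.right i).continuousOn.mono fun x hx => hx.1)
  refine ⟨max C₁ C₂, fun s hs => ?_⟩
  rcases le_total s 1 with h | h
  · exact (h₁ s ⟨hs, h⟩).trans (le_max_left _ _)
  · have hs' : 0 < s := by linarith
    rw [H.iterate_eulerDeriv_eq i hs', norm_mul, norm_pow, norm_neg, norm_one, one_pow, one_mul]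
    exact (h₂ s⁻¹ ⟨(inv_pos.2 hs').le, inv_le_one_of_one_le₀ h⟩).trans (le_max_right _ _)

/-- All iterated Euler derivatives of a function smooth up to `0` and `∞` are Lipschitz: near `0`
the ordinary derivative is bounded by continuity, and for `s ≥ 1` by the next Euler derivative. -/
lemma exists_lipschitz (H : SmoothPair h k) (i : ℕ) :
    ∃ C, ∀ s t, 0 ≤ s → 0 ≤ t → ‖eulerDeriv^[i] h s - eulerDeriv^[i] h t‖ ≤ C * |s - t| := by
  have hsm := contDiffOn_iterate_eulerDeriv H.left i
  obtain ⟨C₁, h₁⟩ := (isCompact_Icc (a := (0 : ℝ)) (b := 1)).exists_bound_of_continuousOn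
    ((hsm.derivWithin (m := ∞) (uniqueDiffOn_Ici 0) (by simp)).continuousOn.mono fun x hx => hx.1)
  obtain ⟨C₂, h₂⟩ := H.exists_bound (i + 1)
  refine ⟨max C₁ C₂, fun s t hs ht => ?_⟩
  refine Convex.norm_image_sub_le_of_norm_derivWithin_le (hsm.differentiableOn (by simp))
    (fun x hx => ?_) (convex_Ici 0) ht hs
  rcases le_total x 1 with h | h
  · exact (h₁ x ⟨hx, h⟩).trans (le_max_left _ _)
  · refine le_trans ?_ ((h₂ x hx).trans (le_max_right _ _))
    rw [Function.iterate_succ_apply', eulerDeriv, norm_mul, Complex.norm_real,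
      Real.norm_of_nonneg hx]
    exact le_mul_of_one_le_left (norm_nonneg _) h

end SmoothPair

/-- In the logarithmic coordinate `x`, the function `h (s e^x)` is smooth for every `s ≥ 0`. -/
lemma contDiff_comp_mul_exp {h : ℝ → ℂ} (hh : ContDiffOn ℝ ∞ h (Ici 0)) {s : ℝ} (hs : 0 ≤ s) :
    ContDiff ℝ ∞ fun x => h (s * Real.exp x) :=
  hh.comp_contDiff (contDiff_const.mul Real.contDiff_exp) fun x => mul_nonneg hs (Real.exp_pos x).le

lemma deriv_comp_mul_exp {h : ℝ → ℂ} (hh : ContDiffOn ℝ ∞ h (Ici 0)) {s : ℝ} (hs : 0 ≤ s) :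
    deriv (fun x => h (s * Real.exp x)) = fun x => eulerDeriv h (s * Real.exp x) := by
  funext x
  have h0 : ∀ x, 0 ≤ s * Real.exp x := fun x => mul_nonneg hs (Real.exp_pos x).le
  have h1 : HasDerivWithinAt (fun x => s * Real.exp x) (s * Real.exp x) univ x :=
    ((Real.hasDerivAt_exp x).const_mul s).hasDerivWithinAt
  have h2 := HasDerivWithinAt.scomp x (hasDerivWithinAt_Ici hh (h0 x)) h1 (fun y _ => h0 y)
  rw [hasDerivWithinAt_univ] at h2
  exact h2.deriv.trans (by rw [eulerDeriv, Complex.real_smul])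

lemma iteratedDeriv_comp_mul_exp {h : ℝ → ℂ} (hh : ContDiffOn ℝ ∞ h (Ici 0)) {s : ℝ}
    (hs : 0 ≤ s) (i : ℕ) :
    iteratedDeriv i (fun x => h (s * Real.exp x)) =
      fun x => eulerDeriv^[i] h (s * Real.exp x) := by
  induction i generalizing h with
  | zero => simp
  | succ i ih =>
    rw [iteratedDeriv_succ', deriv_comp_mul_exp hh hs, ih (contDiffOn_eulerDeriv hh)]
    rfl

/-! ### Uniform bounds on the derivatives of the cutoff functions -/

section Bounds

variable {n : ℕ}

/-- Derivatives of fixed smooth functions are bounded on balls. -/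
lemma exists_bound_iteratedFDeriv {F : Type*} [NormedAddCommGroup F] [NormedSpace ℝ F]
    {f : (Fin n → ℂ) → F} (hf : ContDiff ℝ ∞ f) (R : ℝ) (p : ℕ) :
    ∃ C, 1 ≤ C ∧ ∀ w, ‖w‖ ≤ R → ∀ i ≤ p, ‖iteratedFDeriv ℝ i f w‖ ≤ C := by
  have h : ∀ i : ℕ, ∃ C, ∀ w ∈ Metric.closedBall (0 : Fin n → ℂ) R,
      ‖iteratedFDeriv ℝ i f w‖ ≤ C := fun i =>
    (isCompact_closedBall _ _).exists_bound_of_continuousOn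
      (hf.continuous_iteratedFDeriv (by exact_mod_cast le_top)).continuousOn
  choose C hC using h
  refine ⟨1 + ∑ i ∈ Finset.range (p + 1), |C i|, ?_, fun w hw i hi => ?_⟩
  · have : 0 ≤ ∑ i ∈ Finset.range (p + 1), |C i| := Finset.sum_nonneg fun i _ => abs_nonneg _
    linarith
  · have h1 := hC i w (by simpa using hw)
    have h2 : |C i| ≤ ∑ i ∈ Finset.range (p + 1), |C i| :=
      Finset.single_le_sum (f := fun i => |C i|) (fun i _ => abs_nonneg _)
        (Finset.mem_range.2 (by omega))
    linarith [le_abs_self (C i)]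

/-- The derivatives of order `≤ p` of `f` are bounded by `B` on the ball of radius `R`. -/
def DerivBound (R : ℝ) (p : ℕ) (f : (Fin n → ℂ) → ℂ) (B : ℝ) : Prop :=
  ∀ w, ‖w‖ ≤ R → ∀ i ≤ p, ‖iteratedFDeriv ℝ i f w‖ ≤ B

lemma DerivBound.mul {R : ℝ} {p : ℕ} {f g : (Fin n → ℂ) → ℂ} {A B : ℝ}
    (hf : ContDiff ℝ ∞ f) (hg : ContDiff ℝ ∞ g) (hA : 0 ≤ A) (hB : 0 ≤ B)
    (hfA : DerivBound R p f A) (hgB : DerivBound R p g B) :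
    DerivBound R p (fun w => f w * g w) (2 ^ p * (A * B)) := by
  intro w hw i hi
  refine (norm_iteratedFDeriv_mul_le hf hg w (by exact_mod_cast le_top)).trans ?_
  calc ∑ j ∈ Finset.range (i + 1), (i.choose j : ℝ) * ‖iteratedFDeriv ℝ j f w‖ *
        ‖iteratedFDeriv ℝ (i - j) g w‖
      ≤ ∑ j ∈ Finset.range (i + 1), (i.choose j : ℝ) * (A * B) := by
        refine Finset.sum_le_sum fun j hj => ?_
        have hj' : j ≤ i := by simpa [Nat.lt_succ_iff] using hj
        rw [mul_assoc]
        gcongr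
        · exact hfA w hw j (by omega)
        · exact hgB w hw (i - j) (by omega)
    _ = 2 ^ i * (A * B) := by
        rw [← Finset.sum_mul]
        congr 1
        exact_mod_cast Nat.sum_range_choose i
    _ ≤ 2 ^ p * (A * B) := by
        gcongr
        norm_num

/-- The cutoff in the chart at infinity: `h` evaluated at the multiple `s / Φ(w)`. -/
noncomputable def chartCutoff (h : ℝ → ℂ) (Φ : (Fin n → ℂ) → ℝ) (s : ℝ) (w : Fin n → ℂ) : ℂ :=
  h (s / Φ w)

variable {Φ : (Fin n → ℂ) → ℝ}

lemma chartCutoff_eq_comp (h : ℝ → ℂ) (hpos : ∀ ζ, 0 < Φ ζ) (s : ℝ) :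
    chartCutoff h Φ s = (fun x => h (s * Real.exp x)) ∘ fun w => -Real.log (Φ w) := by
  funext w
  simp [chartCutoff, Real.exp_neg, Real.exp_log (hpos w), div_eq_mul_inv]

lemma contDiff_neg_log (hΦ : ContDiff ℝ ∞ Φ) (hpos : ∀ ζ, 0 < Φ ζ) :
    ContDiff ℝ ∞ fun w => -Real.log (Φ w) :=
  (hΦ.log fun w => (hpos w).ne').neg

lemma contDiff_chartCutoff {h : ℝ → ℂ} (hh : ContDiffOn ℝ ∞ h (Ici 0))
    (hΦ : ContDiff ℝ ∞ Φ) (hpos : ∀ ζ, 0 < Φ ζ) {s : ℝ} (hs : 0 ≤ s) :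
    ContDiff ℝ ∞ (chartCutoff h Φ s) := by
  rw [chartCutoff_eq_comp h hpos]
  exact (contDiff_comp_mul_exp hh hs).comp (contDiff_neg_log hΦ hpos)

/-- The derivatives of the cutoff functions are bounded uniformly in the scaling parameter. -/
lemma exists_derivBound_chartCutoff {h k : ℝ → ℂ} (H : SmoothPair h k) (hΦ : ContDiff ℝ ∞ Φ)
    (hpos : ∀ ζ, 0 < Φ ζ) (R : ℝ) (p : ℕ) :
    ∃ C, 0 ≤ C ∧ ∀ s, 0 ≤ s → DerivBound R p (chartCutoff h Φ s) C := by
  obtain ⟨D, hD1, hD⟩ := exists_bound_iteratedFDeriv (contDiff_neg_log hΦ hpos) R p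
  choose C hC using H.exists_bound
  have hC0 : ∀ i, 0 ≤ C i := fun i => (norm_nonneg _).trans (hC i 0 le_rfl)
  set S := ∑ i ∈ Finset.range (p + 1), C i with hS
  have hS0 : 0 ≤ S := Finset.sum_nonneg fun i _ => hC0 i
  have hCS : ∀ i ≤ p, C i ≤ S := fun i hi =>
    Finset.single_le_sum (fun i _ => hC0 i) (Finset.mem_range.2 (by omega))
  refine ⟨p.factorial * S * D ^ p, by positivity, fun s hs w hw i hi => ?_⟩
  rw [chartCutoff_eq_comp h hpos]
  refine (norm_iteratedFDeriv_comp_le (contDiff_comp_mul_exp H.left hs) (contDiff_neg_log hΦ hpos)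
    (by exact_mod_cast le_top) w (C := S) (D := D) (fun j hj => ?_) (fun j hj1 hj => ?_)).trans ?_
  · rw [norm_iteratedFDeriv_eq_norm_iteratedDeriv, iteratedDeriv_comp_mul_exp H.left hs]
    exact (hC j _ (mul_nonneg hs (Real.exp_pos _).le)).trans (hCS j (hj.trans hi))
  · exact (hD w hw j (hj.trans hi)).trans (le_self_pow₀ hD1 (by omega))
  · gcongr

/-- The derivatives of the cutoff functions are Lipschitz in the scaling parameter, down to the
value `0`, which corresponds to the point at infinity. -/
lemma exists_derivBound_chartCutoff_sub {h k : ℝ → ℂ} (H : SmoothPair h k)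
    (hΦ : ContDiff ℝ ∞ Φ) (hpos : ∀ ζ, 0 < Φ ζ) (R : ℝ) (p : ℕ) :
    ∃ C, 0 ≤ C ∧ ∀ s t, 0 ≤ s → 0 ≤ t → DerivBound R p
      (fun w => chartCutoff h Φ s w - chartCutoff h Φ t w) (C * |s - t|) := by
  obtain ⟨D, hD1, hD⟩ := exists_bound_iteratedFDeriv (contDiff_neg_log hΦ hpos) R p
  choose C hC using H.exists_lipschitz
  have hC0 : ∀ i, 0 ≤ C i := fun i => by
    have := (norm_nonneg _).trans (hC i 1 0 zero_le_one le_rfl)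
    simpa using this
  set S := ∑ i ∈ Finset.range (p + 1), C i with hS
  have hS0 : 0 ≤ S := Finset.sum_nonneg fun i _ => hC0 i
  have hCS : ∀ i ≤ p, C i ≤ S := fun i hi =>
    Finset.single_le_sum (fun i _ => hC0 i) (Finset.mem_range.2 (by omega))
  refine ⟨p.factorial * (S * Real.exp D) * D ^ p, by positivity, fun s t hs ht w hw i hi => ?_⟩
  have heq : (fun w => chartCutoff h Φ s w - chartCutoff h Φ t w) =
      (fun x => h (s * Real.exp x) - h (t * Real.exp x)) ∘ fun w => -Real.log (Φ w) := by
    simp only [chartCutoff_eq_comp h hpos]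
    rfl
  have hLD : -Real.log (Φ w) ≤ D := by
    have := hD w hw 0 (Nat.zero_le _)
    rw [norm_iteratedFDeriv_zero] at this
    exact (le_abs_self _).trans this
  have hs' := contDiff_comp_mul_exp H.left hs
  have ht' := contDiff_comp_mul_exp H.left ht
  rw [heq]
  refine (norm_iteratedFDeriv_comp_le (hs'.sub ht') (contDiff_neg_log hΦ hpos)
    (by exact_mod_cast le_top) w (C := S * Real.exp D * |s - t|) (D := D) (fun j hj => ?_)
    (fun j hj1 hj => ?_)).trans ?_
  · rw [norm_iteratedFDeriv_eq_norm_iteratedDeriv,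
      iteratedDeriv_fun_sub (hs'.contDiffAt.of_le (by exact_mod_cast le_top))
        (ht'.contDiffAt.of_le (by exact_mod_cast le_top)),
      iteratedDeriv_comp_mul_exp H.left hs, iteratedDeriv_comp_mul_exp H.left ht]
    refine (hC j _ _ (mul_nonneg hs (Real.exp_pos _).le)
      (mul_nonneg ht (Real.exp_pos _).le)).trans ?_
    rw [← sub_mul, abs_mul, Real.abs_exp, mul_assoc, mul_comm |s - t|]
    gcongr
    exact hCS j (hj.trans hi)
  · exact (hD w hw j (hj.trans hi)).trans (le_self_pow₀ hD1 (by omega))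
  · have : (p.factorial : ℝ) * (S * Real.exp D) * D ^ p * |s - t| =
        p.factorial * (S * Real.exp D * |s - t|) * D ^ p := by ring
    rw [this]
    gcongr

end Bounds

/-! ### Monomials -/

section Monomial

variable {n : ℕ}

lemma cMonomial_add (m m' : Fin n → ℕ) (ζ : Fin n → ℂ) :
    cMonomial (m + m') ζ = cMonomial m ζ * cMonomial m' ζ := by
  simp [cMonomial, pow_add, Finset.prod_mul_distrib]

lemma cMonomial_smul (k : ℕ) (m : Fin n → ℕ) (ζ : Fin n → ℂ) :
    cMonomial (k • m) ζ = cMonomial m ζ ^ k := by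
  simp only [cMonomial, Pi.smul_apply, smul_eq_mul, ← Finset.prod_pow]
  exact Finset.prod_congr rfl fun j _ => by rw [mul_comm, pow_mul]

lemma norm_cMonomial (m : Fin n → ℕ) (ζ : Fin n → ℂ) :
    ‖cMonomial m ζ‖ = ∏ j, ‖ζ j‖ ^ m j := by
  simp [cMonomial, norm_prod]

lemma cMonomial_ne_zero (m : Fin n → ℕ) {ζ : Fin n → ℂ} (h : ∀ j, ζ j ≠ 0) :
    cMonomial m ζ ≠ 0 :=
  Finset.prod_ne_zero_iff.2 fun j _ => pow_ne_zero _ (h j)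

lemma continuous_cMonomial (m : Fin n → ℕ) : Continuous (cMonomial (n := n) m) := by
  unfold cMonomial
  fun_prop

lemma continuous_torusRotate {N : ℕ} (u : Fin n → rootsOfUnity N ℂ) :
    Continuous (torusRotate u) := by
  unfold torusRotate
  fun_prop

lemma measurableEmbedding_torusRotate {N : ℕ} (u : Fin n → rootsOfUnity N ℂ) :
    MeasurableEmbedding (torusRotate u) := by
  refine (continuous_torusRotate u).measurableEmbedding fun ζ ξ h => funext fun j => ?_
  exact mul_left_cancel₀ (Units.ne_zero (u j : ℂˣ)) (congrFun h j)

lemma norm_cMonomial_torusRotate {N : ℕ} [NeZero N] (m : Fin n → ℕ)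
    (u : Fin n → rootsOfUnity N ℂ) (ζ : Fin n → ℂ) :
    ‖cMonomial m (torusRotate u ζ)‖ = ‖cMonomial m ζ‖ := by
  simp [norm_cMonomial, norm_torusRotate_apply]

lemma inv_cMonomial_torusRotate {N : ℕ} (m : Fin n → ℕ)
    (u : Fin n → rootsOfUnity N ℂ) (ζ : Fin n → ℂ) :
    (cMonomial m (torusRotate u ζ))⁻¹ =
      torusWeight (fun j => (m j : ℤ)) u * (cMonomial m ζ)⁻¹ := by
  simp [cMonomial, torusRotate, torusWeight, mul_pow, Finset.prod_mul_distrib, mul_comm]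

lemma ae_forall_apply_ne_zero : ∀ᵐ ζ : Fin n → ℂ, ∀ j, ζ j ≠ 0 :=
  ae_all_iff.2 fun j => Measure.ae_eval_ne (fun _ : Fin n => (volume : Measure ℂ)) j 0

end Monomial

/-! ### Integrals of torus averages -/

section Integration

variable {n N : ℕ} [NeZero N]

lemma measurePreserving_torusRotate (u : Fin n → rootsOfUnity N ℂ) :
    MeasurePreserving (torusRotate u) volume volume := by
  refine volume_preserving_pi (f := fun j (z : ℂ) => ((u j : ℂˣ) : ℂ) * z) fun j => ?_
  exact (rotation ⟨((u j : ℂˣ) : ℂ),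
    mem_sphere_zero_iff_norm.2 (norm_coe_rootsOfUnity (u j))⟩).measurePreserving

lemma aestronglyMeasurable_torusAverage (M : Fin n → ℤ) {f : (Fin n → ℂ) → ℂ}
    (hf : AEStronglyMeasurable f) : AEStronglyMeasurable (torusAverage N M f) := by
  refine (Finset.aestronglyMeasurable_fun_sum _ fun u _ => ?_).const_mul _
  exact (hf.comp_measurePreserving (measurePreserving_torusRotate u)).const_mul _

/-- Averaging `f` in the weight of `ζ ^ m` does not change the integral of `f / ζ ^ m` over a
rotation invariant set. -/
lemma setIntegral_torusAverage (m : Fin n → ℕ) {f : (Fin n → ℂ) → ℂ} {S : Set (Fin n → ℂ)}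
    (hS : MeasurableSet S)
    (hrot : ∀ (u : Fin n → rootsOfUnity N ℂ) ζ, torusRotate u ζ ∈ S ↔ ζ ∈ S)
    (hf : IntegrableOn (fun ζ => f ζ / cMonomial m ζ) S) :
    ∫ ζ in S, torusAverage N (fun j => (m j : ℤ)) f ζ / cMonomial m ζ =
      ∫ ζ in S, f ζ / cMonomial m ζ := by
  set G : (Fin n → ℂ) → ℂ := S.indicator fun ζ => f ζ / cMonomial m ζ with hG
  have hGi : Integrable G := (integrable_indicator_iff hS).2 hf
  have hGu : ∀ u : Fin n → rootsOfUnity N ℂ, Integrable fun ζ => G (torusRotate u ζ) := fun u =>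
    ((measurePreserving_torusRotate u).integrable_comp_emb (measurableEmbedding_torusRotate u)).2
      hGi
  have hpt : ∀ ζ, S.indicator
      (fun ζ => torusAverage N (fun j => (m j : ℤ)) f ζ / cMonomial m ζ) ζ =
        (Fintype.card (Fin n → rootsOfUnity N ℂ) : ℂ)⁻¹ *
          ∑ u : Fin n → rootsOfUnity N ℂ, G (torusRotate u ζ) := by
    intro ζ
    by_cases hζ : ζ ∈ S
    · simp only [hG, indicator_of_mem hζ, indicator_of_mem ((hrot _ ζ).2 hζ), torusAverage]
      rw [mul_div_assoc, Finset.sum_div]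
      congr 1
      refine Finset.sum_congr rfl fun u _ => ?_
      rw [div_eq_mul_inv, div_eq_mul_inv, inv_cMonomial_torusRotate]
      ring
    · simp [hG, indicator_of_notMem hζ, indicator_of_notMem (mt (hrot _ ζ).1 hζ)]
  have hcard : (Fintype.card (Fin n → rootsOfUnity N ℂ) : ℂ) ≠ 0 :=
    Nat.cast_ne_zero.2 Fintype.card_ne_zero
  rw [← integral_indicator hS, ← integral_indicator hS, integral_congr_ae (ae_of_all _ hpt),
    integral_const_mul, integral_finsetSum _ fun u _ => hGu u]
  simp_rw [(measurePreserving_torusRotate _).integral_comp (measurableEmbedding_torusRotate _) G]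
  rw [Finset.sum_const, Finset.card_univ, nsmul_eq_mul, ← mul_assoc, inv_mul_cancel₀ hcard,
    one_mul]

/-- The integral of `f / ζ ^ m` after averaging `f` over rotations in the weight of `ζ ^ m`. For
smooth `f` the average is divisible by `ζ ^ m`, so that this is an absolutely convergent
expression of the principal value of `f / ζ ^ m`. -/
noncomputable def averagedIntegral (N : ℕ) [NeZero N] (m : Fin n → ℕ) (f : (Fin n → ℂ) → ℂ) : ℂ :=
  ∫ ζ, torusAverage N (fun j => (m j : ℤ)) f ζ / cMonomial m ζ

lemma averagedIntegral_const_mul (m : Fin n → ℕ) (c : ℂ) (f : (Fin n → ℂ) → ℂ) :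
    averagedIntegral N m (fun ζ => c * f ζ) = c * averagedIntegral N m f := by
  simp only [averagedIntegral, torusAverage_const_mul, mul_div_assoc, integral_const_mul]

lemma averagedIntegral_eq_integral (m : Fin n → ℕ) {f : (Fin n → ℂ) → ℂ}
    (hf : Integrable fun ζ => f ζ / cMonomial m ζ) :
    averagedIntegral N m f = ∫ ζ, f ζ / cMonomial m ζ := by
  have := setIntegral_torusAverage (N := N) m MeasurableSet.univ (fun _ _ => by simp)
    hf.integrableOn
  simpa [averagedIntegral] using this

lemma measurableSet_cMonomial_gt (m : Fin n → ℕ) (δ : ℝ) :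
    MeasurableSet {ζ : Fin n → ℂ | δ < ‖cMonomial m ζ‖ ^ 2} :=
  (isOpen_lt continuous_const ((continuous_cMonomial m).norm.pow 2)).measurableSet

lemma integrableOn_div_cMonomial (m : Fin n → ℕ) {ψ : (Fin n → ℂ) → ℂ} (hψ : Integrable ψ)
    {δ : ℝ} (hδ : 0 < δ) :
    IntegrableOn (fun ζ => ψ ζ / cMonomial m ζ) {ζ : Fin n → ℂ | δ < ‖cMonomial m ζ‖ ^ 2} := by
  simp only [div_eq_inv_mul]
  refine Integrable.bdd_mul (c := (Real.sqrt δ)⁻¹) hψ.integrableOn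
    (continuous_cMonomial m).measurable.inv.aestronglyMeasurable ?_
  filter_upwards [ae_restrict_mem (measurableSet_cMonomial_gt m δ)] with ζ hζ
  rw [norm_inv]
  exact inv_anti₀ (Real.sqrt_pos.2 hδ) (Real.sqrt_le_iff.2 ⟨norm_nonneg _, hζ.le⟩)

/-- The principal value of `ψ / ζ ^ m'` is the averaged integral of `f / ζ ^ m` whenever the two
quotients agree almost everywhere and the latter converges absolutely: the truncations are
invariant under rotation, so the average may be taken before the limit. -/
theorem tendsto_truncatedIntegral (m m' : Fin n → ℕ) {ψ f : (Fin n → ℂ) → ℂ} (hψ : Integrable ψ)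
    (hf : ∀ᵐ ζ, ψ ζ / cMonomial m' ζ = f ζ / cMonomial m ζ)
    (hint : Integrable fun ζ => torusAverage N (fun j => (m j : ℤ)) f ζ / cMonomial m ζ) :
    Tendsto (truncatedIntegral m' ψ) (𝓝[>] 0) (𝓝 (averagedIntegral N m f)) := by
  set g := fun ζ => torusAverage N (fun j => (m j : ℤ)) f ζ / cMonomial m ζ with hg
  have hlim : Tendsto (fun δ : ℝ => ∫ ζ, {ζ : Fin n → ℂ | δ < ‖cMonomial m' ζ‖ ^ 2}.indicator g ζ)
      (𝓝[>] 0) (𝓝 (∫ ζ, g ζ)) := by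
    refine tendsto_integral_filter_of_dominated_convergence (fun ζ => ‖g ζ‖)
      (.of_forall fun δ => hint.aestronglyMeasurable.indicator (measurableSet_cMonomial_gt m' δ))
      (.of_forall fun δ => .of_forall fun ζ => norm_indicator_le_norm_self _ _) hint.norm ?_
    filter_upwards [ae_forall_apply_ne_zero] with ζ hζ
    refine tendsto_const_nhds.congr' ?_
    have hpos : 0 < ‖cMonomial m' ζ‖ ^ 2 := pow_pos (norm_pos_iff.2 (cMonomial_ne_zero m' hζ)) 2
    filter_upwards [nhdsWithin_le_nhds (gt_mem_nhds hpos)] with δ hδ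
    rw [indicator_of_mem]
    exact hδ
  refine hlim.congr' ?_
  filter_upwards [self_mem_nhdsWithin] with δ hδ
  have hψ' := integrableOn_div_cMonomial m' hψ hδ
  have hf' := ae_restrict_of_ae (s := {ζ : Fin n → ℂ | δ < ‖cMonomial m' ζ‖ ^ 2}) hf
  rw [integral_indicator (measurableSet_cMonomial_gt m' δ), truncatedIntegral,
    integral_congr_ae hf', hg, setIntegral_torusAverage m (measurableSet_cMonomial_gt m' δ)]
  · intro u ζ
    simp only [mem_ofPred_eq, norm_cMonomial_torusRotate]
  · exact hψ'.congr hf'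

lemma integrable_of_bound_ball {f : (Fin n → ℂ) → ℂ} {R C : ℝ} (hm : AEStronglyMeasurable f)
    (hb : ∀ ζ, ‖ζ‖ ≤ R → ‖f ζ‖ ≤ C) (h0 : ∀ ζ, R < ‖ζ‖ → f ζ = 0) : Integrable f := by
  have h : Integrable ((Metric.closedBall (0 : Fin n → ℂ) R).indicator fun _ => C) :=
    (integrable_indicator_iff Metric.isClosed_closedBall.measurableSet).2
      (integrableOn_const (isCompact_closedBall _ _).measure_lt_top.ne)
  refine h.mono' hm (.of_forall fun ζ => ?_)
  by_cases hζ : ‖ζ‖ ≤ R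
  · rw [indicator_of_mem (by simpa using hζ)]
    exact hb ζ hζ
  · rw [h0 ζ (not_le.1 hζ), indicator_of_notMem (by simpa using hζ), norm_zero]

/-- Negative powers of the modulus of a monomial are integrable on balls, as long as each variable
occurs with an exponent larger than `-2`, the real dimension of the variable. -/
lemma exists_integrable_rpow_cMonomial (m : Fin n → ℕ) (R r : ℝ) (hr : ∀ j, 2 * (r * m j) < 2) :
    ∃ g : (Fin n → ℂ) → ℝ, Integrable g ∧ (∀ ζ, 0 ≤ g ζ) ∧
      ∀ ζ, ‖ζ‖ ≤ R → ((‖cMonomial m ζ‖ ^ 2) ^ r)⁻¹ ≤ g ζ := by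
  refine ⟨fun ζ => ∏ j, (Metric.ball (0 : ℂ) (R + 1)).indicator
    (fun z => ‖z‖ ^ (-(2 * (r * m j)))) (ζ j), ?_, fun ζ => ?_, fun ζ hζ => ?_⟩
  · refine Integrable.fintype_prod (f := fun j => (Metric.ball (0 : ℂ) (R + 1)).indicator
      (fun z : ℂ => ‖z‖ ^ (-(2 * (r * m j))))) fun j => ?_
    refine (integrable_indicator_iff Metric.isOpen_ball.measurableSet).2 ?_
    refine integrableOn_ball_of_norm_le_rpow (C := 1) (α := 2 * (r * m j)) ?_ ?_ ?_ ?_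
    · simp [Complex.finrank_real_complex]
    · simpa [Complex.finrank_real_complex] using hr j
    · refine .of_forall fun z => ?_
      rw [one_mul, Real.norm_of_nonneg (by positivity)]
    · exact (measurable_norm.pow_const _).aestronglyMeasurable
  · exact Finset.prod_nonneg fun j _ => indicator_nonneg (fun z _ => by positivity) _
  · refine le_of_eq ?_
    rw [norm_cMonomial, ← Finset.prod_pow,
      ← Real.finsetProd_rpow _ _ fun j _ => by positivity, ← Finset.prod_inv_distrib]
    refine Finset.prod_congr rfl fun j _ => ?_
    have hj : ζ j ∈ Metric.ball (0 : ℂ) (R + 1) := by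
      have := (norm_le_pi_norm ζ j).trans hζ
      simp only [mem_ball_zero_iff]
      linarith
    rw [indicator_of_mem hj, Real.rpow_neg (norm_nonneg _), ← pow_mul, ← Real.rpow_natCast,
      ← Real.rpow_mul (norm_nonneg _)]
    congr 2
    push_cast
    ring

end Integration

/-! ### The averaged integral of two cutoff functions -/

section Amplitude

variable {n : ℕ}

/-- The product of two cutoff functions and a test function, with scaling parameters that do not
depend on the point. -/
noncomputable def amplitude (h₁ h₂ : ℝ → ℂ) (Φ Ψ : (Fin n → ℂ) → ℝ) (φ : (Fin n → ℂ) → ℂ)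
    (s : ℝ × ℝ) (w : Fin n → ℂ) : ℂ :=
  chartCutoff h₁ Φ s.1 w * chartCutoff h₂ Ψ s.2 w * φ w

/-- The scaling parameters `(ε₁ / |ζ ^ α|², ε₂ / |ζ ^ β|²)`, which are invariant under rotation.
On the null set `ζ ^ α = 0` the first one has the value `0`, by the convention for division by
zero; likewise for the second. -/
noncomputable def scaling (α β : Fin n → ℕ) (ε : ℝ × ℝ) (ζ : Fin n → ℂ) : ℝ × ℝ :=
  (ε.1 / ‖cMonomial α ζ‖ ^ 2, ε.2 / ‖cMonomial β ζ‖ ^ 2)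

/-- The product of the test function and the two cutoff functions of `Φ |ζ ^ α|² / ε₁` and
`Ψ |ζ ^ β|² / ε₂`, written in the chart at infinity. -/
noncomputable def regNumerator (h₁ h₂ : ℝ → ℂ) (Φ Ψ : (Fin n → ℂ) → ℝ) (α β : Fin n → ℕ)
    (φ : (Fin n → ℂ) → ℂ) (ε : ℝ × ℝ) (ζ : Fin n → ℂ) : ℂ :=
  amplitude h₁ h₂ Φ Ψ φ (scaling α β ε ζ) ζ

variable {h₁ k₁ h₂ k₂ : ℝ → ℂ} {Φ Ψ : (Fin n → ℂ) → ℝ} {φ : (Fin n → ℂ) → ℂ} {α β : Fin n → ℕ}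

lemma torusAverage_regNumerator {N : ℕ} [NeZero N] (M : Fin n → ℤ) (ε : ℝ × ℝ) (ζ : Fin n → ℂ) :
    torusAverage N M (regNumerator h₁ h₂ Φ Ψ α β φ ε) ζ =
      torusAverage N M (amplitude h₁ h₂ Φ Ψ φ (scaling α β ε ζ)) ζ := by
  refine torusAverage_congr M fun u => ?_
  simp only [regNumerator, scaling, norm_cMonomial_torusRotate]

lemma scaling_nonneg {ε : ℝ × ℝ} (hε : 0 ≤ ε.1 ∧ 0 ≤ ε.2) (ζ : Fin n → ℂ) :
    0 ≤ (scaling α β ε ζ).1 ∧ 0 ≤ (scaling α β ε ζ).2 :=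
  ⟨div_nonneg hε.1 (by positivity), div_nonneg hε.2 (by positivity)⟩

lemma contDiff_amplitude (H₁ : SmoothPair h₁ k₁) (H₂ : SmoothPair h₂ k₂)
    (hΦ : ContDiff ℝ ∞ Φ) (hΦpos : ∀ ζ, 0 < Φ ζ) (hΨ : ContDiff ℝ ∞ Ψ) (hΨpos : ∀ ζ, 0 < Ψ ζ)
    (hφ : ContDiff ℝ ∞ φ) {s : ℝ × ℝ} (hs : 0 ≤ s.1 ∧ 0 ≤ s.2) :
    ContDiff ℝ ∞ (amplitude h₁ h₂ Φ Ψ φ s) :=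
  ((contDiff_chartCutoff H₁.left hΦ hΦpos hs.1).mul
    (contDiff_chartCutoff H₂.left hΨ hΨpos hs.2)).mul hφ

/-- Bounds on the derivatives of the amplitudes that are uniform in the scaling parameters, and
Lipschitz in them. -/
lemma exists_derivBound_amplitude (H₁ : SmoothPair h₁ k₁) (H₂ : SmoothPair h₂ k₂)
    (hΦ : ContDiff ℝ ∞ Φ) (hΦpos : ∀ ζ, 0 < Φ ζ) (hΨ : ContDiff ℝ ∞ Ψ) (hΨpos : ∀ ζ, 0 < Ψ ζ)
    (hφ : ContDiff ℝ ∞ φ) (R : ℝ) (p : ℕ) :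
    ∃ C, 0 ≤ C ∧ (∀ s : ℝ × ℝ, 0 ≤ s.1 ∧ 0 ≤ s.2 → DerivBound R p (amplitude h₁ h₂ Φ Ψ φ s) C) ∧
      ∀ s t : ℝ × ℝ, 0 ≤ s.1 ∧ 0 ≤ s.2 → 0 ≤ t.1 ∧ 0 ≤ t.2 →
        DerivBound R p (fun w => amplitude h₁ h₂ Φ Ψ φ s w - amplitude h₁ h₂ Φ Ψ φ t w)
          (C * (|s.1 - t.1| + |s.2 - t.2|)) := by
  obtain ⟨A₁, hA₁, hA₁'⟩ := exists_derivBound_chartCutoff H₁ hΦ hΦpos R p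
  obtain ⟨A₂, hA₂, hA₂'⟩ := exists_derivBound_chartCutoff H₂ hΨ hΨpos R p
  obtain ⟨L₁, hL₁, hL₁'⟩ := exists_derivBound_chartCutoff_sub H₁ hΦ hΦpos R p
  obtain ⟨L₂, hL₂, hL₂'⟩ := exists_derivBound_chartCutoff_sub H₂ hΨ hΨpos R p
  obtain ⟨B, hB, hB'⟩ := exists_bound_iteratedFDeriv hφ R p
  have hB0 : 0 ≤ B := zero_le_one.trans hB
  have sm₁ : ∀ s, 0 ≤ s → ContDiff ℝ ∞ (chartCutoff h₁ Φ s) := fun s hs =>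
    contDiff_chartCutoff H₁.left hΦ hΦpos hs
  have sm₂ : ∀ s, 0 ≤ s → ContDiff ℝ ∞ (chartCutoff h₂ Ψ s) := fun s hs =>
    contDiff_chartCutoff H₂.left hΨ hΨpos hs
  set K : ℝ := 2 ^ p * (2 ^ p * (A₁ * A₂ + L₁ * A₂ + A₁ * L₂) * B) with hK
  refine ⟨K, by positivity, fun s hs w hw i hi => ?_, fun s t hs ht w hw i hi => ?_⟩
  · refine ((DerivBound.mul ((sm₁ _ hs.1).mul (sm₂ _ hs.2)) hφ (by positivity) hB0
      (DerivBound.mul (sm₁ _ hs.1) (sm₂ _ hs.2) hA₁ hA₂ (hA₁' _ hs.1) (hA₂' _ hs.2)) hB')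
        w hw i hi).trans ?_
    rw [hK]
    gcongr
    nlinarith [mul_nonneg hL₁ hA₂, mul_nonneg hA₁ hL₂]
  -- For the difference, one cutoff function is changed at a time.
  · have heq : (fun w => amplitude h₁ h₂ Φ Ψ φ s w - amplitude h₁ h₂ Φ Ψ φ t w) =
        (fun w =>
          (chartCutoff h₁ Φ s.1 w - chartCutoff h₁ Φ t.1 w) * chartCutoff h₂ Ψ s.2 w * φ w) +
        fun w =>
          chartCutoff h₁ Φ t.1 w * (chartCutoff h₂ Ψ s.2 w - chartCutoff h₂ Ψ t.2 w) * φ w := by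
      funext w
      simp only [amplitude, Pi.add_apply]
      ring
    have d₁ := (sm₁ _ hs.1).sub (sm₁ _ ht.1)
    have d₂ := (sm₂ _ hs.2).sub (sm₂ _ ht.2)
    have e₁ := (d₁.mul (sm₂ _ hs.2)).mul hφ
    have e₂ := ((sm₁ _ ht.1).mul d₂).mul hφ
    have b₁ := (DerivBound.mul (d₁.mul (sm₂ _ hs.2)) hφ (by positivity) hB0
      (DerivBound.mul d₁ (sm₂ _ hs.2) (by positivity) hA₂ (hL₁' _ _ hs.1 ht.1) (hA₂' _ hs.2)) hB')
        w hw i hi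
    have b₂ := (DerivBound.mul ((sm₁ _ ht.1).mul d₂) hφ (by positivity) hB0
      (DerivBound.mul (sm₁ _ ht.1) d₂ hA₁ (by positivity) (hA₁' _ ht.1) (hL₂' _ _ hs.2 ht.2)) hB')
        w hw i hi
    rw [heq, iteratedFDeriv_add (e₁.of_le (by exact_mod_cast le_top))
      (e₂.of_le (by exact_mod_cast le_top))]
    refine (norm_add_le _ _).trans ((add_le_add b₁ b₂).trans ?_)
    have x₁ := abs_nonneg (s.1 - t.1)
    have x₂ := abs_nonneg (s.2 - t.2)
    rw [hK, ← mul_add, ← add_mul, ← mul_add, mul_assoc (2 ^ p : ℝ) (_ * B), mul_right_comm _ B,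
      mul_assoc (2 ^ p : ℝ) _ (_ + _)]
    gcongr
    nlinarith [mul_nonneg (mul_nonneg hA₁ hA₂) x₁, mul_nonneg (mul_nonneg hA₁ hA₂) x₂,
      mul_nonneg (mul_nonneg hL₁ hA₂) x₂, mul_nonneg (mul_nonneg hA₁ hL₂) x₁]

/-- The weight `m` average of the amplitudes is divisible by `ζ ^ m`, with uniform and Lipschitz
bounds in the scaling parameters. -/
lemma exists_bound_torusAverage_amplitude {N : ℕ} [NeZero N] (H₁ : SmoothPair h₁ k₁)
    (H₂ : SmoothPair h₂ k₂) (hΦ : ContDiff ℝ ∞ Φ) (hΦpos : ∀ ζ, 0 < Φ ζ) (hΨ : ContDiff ℝ ∞ Ψ)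
    (hΨpos : ∀ ζ, 0 < Ψ ζ) (hφ : ContDiff ℝ ∞ φ) (R : ℝ) (m : Fin n → ℕ)
    (hN : ∀ j, 2 * m j ≤ N) :
    ∃ C, 0 ≤ C ∧
      (∀ s : ℝ × ℝ, 0 ≤ s.1 ∧ 0 ≤ s.2 → ∀ ζ, ‖ζ‖ ≤ R →
        ‖torusAverage N (fun j => (m j : ℤ)) (amplitude h₁ h₂ Φ Ψ φ s) ζ / cMonomial m ζ‖ ≤ C) ∧
      ∀ s t : ℝ × ℝ, 0 ≤ s.1 ∧ 0 ≤ s.2 → 0 ≤ t.1 ∧ 0 ≤ t.2 → ∀ ζ, ‖ζ‖ ≤ R →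
        ‖torusAverage N (fun j => (m j : ℤ)) (amplitude h₁ h₂ Φ Ψ φ s) ζ / cMonomial m ζ -
          torusAverage N (fun j => (m j : ℤ)) (amplitude h₁ h₂ Φ Ψ φ t) ζ / cMonomial m ζ‖ ≤
            C * (|s.1 - t.1| + |s.2 - t.2|) := by
  obtain ⟨C, hC, hb, hl⟩ :=
    exists_derivBound_amplitude H₁ H₂ hΦ hΦpos hΨ hΨpos hφ R (∑ j, m j)
  have sm : ∀ s : ℝ × ℝ, 0 ≤ s.1 ∧ 0 ≤ s.2 → ContDiff ℝ ∞ (amplitude h₁ h₂ Φ Ψ φ s) :=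
    fun s hs => contDiff_amplitude H₁ H₂ hΦ hΦpos hΨ hΨpos hφ hs
  have key : ∀ (f : (Fin n → ℂ) → ℂ) (B : ℝ), ContDiff ℝ ∞ f → 0 ≤ B →
      DerivBound R (∑ j, m j) f B → ∀ ζ, ‖ζ‖ ≤ R →
      ‖torusAverage N (fun j => (m j : ℤ)) f ζ / cMonomial m ζ‖ ≤ 2 ^ (∑ j, m j) * B := by
    intro f B hf hB0 hB ζ hζ
    have h := norm_torusAverage_le (N := N) R (∑ j, m j) m rfl (fun j => (m j : ℤ))
      (fun j => le_rfl) (fun j => by have := hN j; omega) hf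
      (fun w hw => hB w hw _ le_rfl) ζ hζ
    rw [norm_div, norm_cMonomial]
    exact div_le_of_le_mul₀ (by positivity) (by positivity) h
  refine ⟨2 ^ (∑ j, m j) * C, by positivity, fun s hs ζ hζ => key _ _ (sm s hs) hC (hb s hs) ζ hζ,
    fun s t hs ht ζ hζ => ?_⟩
  rw [← sub_div, ← torusAverage_sub, mul_assoc]
  exact key _ _ ((sm s hs).sub (sm t ht)) (by positivity) (hl s t hs ht) ζ hζ

lemma continuous_comp_max {h : ℝ → ℂ} (hh : ContDiffOn ℝ ∞ h (Ici 0)) :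
    Continuous fun s => h (max s 0) :=
  hh.continuousOn.comp_continuous (by fun_prop) fun s => le_max_right s 0

lemma measurable_regNumerator (H₁ : SmoothPair h₁ k₁) (H₂ : SmoothPair h₂ k₂)
    (hΦ : Continuous Φ) (hΦpos : ∀ ζ, 0 < Φ ζ) (hΨ : Continuous Ψ) (hΨpos : ∀ ζ, 0 < Ψ ζ)
    (hφ : Continuous φ) {ε : ℝ × ℝ} (hε : 0 ≤ ε.1 ∧ 0 ≤ ε.2) :
    Measurable (regNumerator h₁ h₂ Φ Ψ α β φ ε) := by
  have heq : regNumerator h₁ h₂ Φ Ψ α β φ ε = fun ζ =>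
      h₁ (max (ε.1 / ‖cMonomial α ζ‖ ^ 2 / Φ ζ) 0) *
        h₂ (max (ε.2 / ‖cMonomial β ζ‖ ^ 2 / Ψ ζ) 0) * φ ζ := by
    funext ζ
    have h₁ : 0 ≤ ε.1 / ‖cMonomial α ζ‖ ^ 2 := div_nonneg hε.1 (by positivity)
    have h₂ : 0 ≤ ε.2 / ‖cMonomial β ζ‖ ^ 2 := div_nonneg hε.2 (by positivity)
    rw [max_eq_left (div_nonneg h₁ (hΦpos ζ).le), max_eq_left (div_nonneg h₂ (hΨpos ζ).le)]
    rfl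
  have hα := (continuous_cMonomial α).measurable
  have hβ := (continuous_cMonomial β).measurable
  rw [heq]
  exact (((continuous_comp_max H₁.left).measurable.comp
      ((measurable_const.div (hα.norm.pow_const 2)).div hΦ.measurable)).mul
    ((continuous_comp_max H₂.left).measurable.comp
      ((measurable_const.div (hβ.norm.pow_const 2)).div hΨ.measurable))).mul hφ.measurable

lemma torusAverage_amplitude_eq_zero {N : ℕ} [NeZero N] {R : ℝ} (h0 : ∀ ζ, R < ‖ζ‖ → φ ζ = 0)
    (M : Fin n → ℤ) (s : ℝ × ℝ) {ζ : Fin n → ℂ} (hζ : R < ‖ζ‖) :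
    torusAverage N M (amplitude h₁ h₂ Φ Ψ φ s) ζ = 0 := by
  rw [torusAverage, Finset.sum_eq_zero, mul_zero]
  intro u _
  rw [amplitude, h0 _ (by rwa [norm_torusRotate]), mul_zero, mul_zero]

lemma integrable_torusAverage_regNumerator {N : ℕ} [NeZero N] (H₁ : SmoothPair h₁ k₁)
    (H₂ : SmoothPair h₂ k₂) (hΦ : ContDiff ℝ ∞ Φ) (hΦpos : ∀ ζ, 0 < Φ ζ) (hΨ : ContDiff ℝ ∞ Ψ)
    (hΨpos : ∀ ζ, 0 < Ψ ζ) (hφ : ContDiff ℝ ∞ φ) (hφc : HasCompactSupport φ) (m : Fin n → ℕ)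
    (hN : ∀ j, 2 * m j ≤ N) {ε : ℝ × ℝ} (hε : 0 ≤ ε.1 ∧ 0 ≤ ε.2) :
    Integrable fun ζ =>
      torusAverage N (fun j => (m j : ℤ)) (regNumerator h₁ h₂ Φ Ψ α β φ ε) ζ / cMonomial m ζ := by
  obtain ⟨R, -, hR⟩ := hφc.exists_pos_le_norm
  obtain ⟨C, -, hC, -⟩ :=
    exists_bound_torusAverage_amplitude H₁ H₂ hΦ hΦpos hΨ hΨpos hφ R m hN
  refine integrable_of_bound_ball (R := R) (C := C) ?_ (fun ζ hζ => ?_) fun ζ hζ => ?_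
  · exact (aestronglyMeasurable_torusAverage _ (measurable_regNumerator H₁ H₂ hΦ.continuous hΦpos
      hΨ.continuous hΨpos hφ.continuous hε).aestronglyMeasurable).div₀
        (continuous_cMonomial m).aestronglyMeasurable
  · rw [torusAverage_regNumerator]
    exact hC _ (scaling_nonneg hε ζ) ζ hζ
  · rw [torusAverage_regNumerator, torusAverage_amplitude_eq_zero (fun ζ h => hR ζ h.le) _ _ hζ,
      zero_div]

lemma min_one_add_le_rpow {x y r : ℝ} (hx : 0 ≤ x) (hy : 0 ≤ y) (hr : 0 ≤ r) (hr1 : r ≤ 1) :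
    min 1 (x + y) ≤ x ^ r + y ^ r := by
  refine le_trans ?_ (Real.rpow_add_le_add_rpow hx hy hr hr1)
  rcases le_total 1 (x + y) with h | h
  · exact (min_le_left _ _).trans (Real.one_le_rpow h hr)
  · refine (min_le_right _ _).trans ?_
    rcases (add_nonneg hx hy).eq_or_lt with h0 | h0
    · rw [← h0]; exact Real.rpow_nonneg le_rfl r
    · simpa using Real.rpow_le_rpow_of_exponent_ge h0 h hr1

/-- Hölder continuity of the averaged integral. The quotient of the average by `ζ ^ m` is bounded
and Lipschitz in `ε₁ / |ζ ^ α|²` and `ε₂ / |ζ ^ β|²`, hence Hölder continuous of exponent `r` with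
a constant integrable in `ζ`. -/
theorem exists_averagedIntegral_sub_le {N : ℕ} [NeZero N] (H₁ : SmoothPair h₁ k₁)
    (H₂ : SmoothPair h₂ k₂) (hΦ : ContDiff ℝ ∞ Φ) (hΦpos : ∀ ζ, 0 < Φ ζ) (hΨ : ContDiff ℝ ∞ Ψ)
    (hΨpos : ∀ ζ, 0 < Ψ ζ) (hφ : ContDiff ℝ ∞ φ) (hφc : HasCompactSupport φ) (m : Fin n → ℕ)
    (hN : ∀ j, 2 * m j ≤ N) {r : ℝ} (hr : 0 ≤ r) (hr1 : r ≤ 1)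
    (hα : ∀ j, 2 * (r * α j) < 2) (hβ : ∀ j, 2 * (r * β j) < 2) :
    ∃ C, 0 ≤ C ∧ ∀ ε ε' : ℝ × ℝ, 0 ≤ ε.1 ∧ 0 ≤ ε.2 → 0 ≤ ε'.1 ∧ 0 ≤ ε'.2 →
      ‖averagedIntegral N m (regNumerator h₁ h₂ Φ Ψ α β φ ε) -
        averagedIntegral N m (regNumerator h₁ h₂ Φ Ψ α β φ ε')‖ ≤ C * dist ε ε' ^ r := by
  obtain ⟨R, -, hR⟩ := hφc.exists_pos_le_norm
  obtain ⟨C, hC, hb, hl⟩ :=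
    exists_bound_torusAverage_amplitude H₁ H₂ hΦ hΦpos hΨ hΨpos hφ R m hN
  obtain ⟨gα, gα_int, gα_nonneg, hgα⟩ := exists_integrable_rpow_cMonomial α R r hα
  obtain ⟨gβ, gβ_int, gβ_nonneg, hgβ⟩ := exists_integrable_rpow_cMonomial β R r hβ
  refine ⟨2 * C * (∫ ζ, gα ζ + gβ ζ), mul_nonneg (by positivity)
    (integral_nonneg fun ζ => add_nonneg (gα_nonneg ζ) (gβ_nonneg ζ)), fun ε ε' hε hε' => ?_⟩
  have hint : ∀ ε : ℝ × ℝ, 0 ≤ ε.1 ∧ 0 ≤ ε.2 → _ := fun ε hε =>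
    integrable_torusAverage_regNumerator (α := α) (β := β) H₁ H₂ hΦ hΦpos hΨ hΨpos hφ hφc m hN hε
  rw [averagedIntegral, averagedIntegral, ← integral_sub (hint ε hε) (hint ε' hε')]
  have hscale : ∀ (x y a : ℝ), |x - y| ≤ dist ε ε' → 0 ≤ a → ∀ b, (a ^ r)⁻¹ ≤ b →
      |x / a - y / a| ^ r ≤ dist ε ε' ^ r * b := by
    intro x y a hxy ha b hab
    rw [← sub_div, abs_div, abs_of_nonneg ha, Real.div_rpow (abs_nonneg _) ha, div_eq_mul_inv]
    gcongr
  have hd₁ : |ε.1 - ε'.1| ≤ dist ε ε' := by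
    rw [← Real.dist_eq, Prod.dist_eq]; exact le_max_left _ _
  have hd₂ : |ε.2 - ε'.2| ≤ dist ε ε' := by
    rw [← Real.dist_eq, Prod.dist_eq]; exact le_max_right _ _
  have hbound := norm_integral_le_of_norm_le
    (((gα_int.add gβ_int).const_mul (2 * C * dist ε ε' ^ r))) (f := fun ζ =>
      torusAverage N (fun j => (m j : ℤ)) (regNumerator h₁ h₂ Φ Ψ α β φ ε) ζ / cMonomial m ζ -
      torusAverage N (fun j => (m j : ℤ)) (regNumerator h₁ h₂ Φ Ψ α β φ ε') ζ / cMonomial m ζ)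
    (.of_forall fun ζ => ?_)
  · refine hbound.trans (le_of_eq ?_)
    rw [integral_const_mul]
    simp only [Pi.add_apply]
    ring
  · simp only [torusAverage_regNumerator, Pi.add_apply]
    by_cases hζ : ‖ζ‖ ≤ R
    · have hs := scaling_nonneg (α := α) (β := β) hε ζ
      have hs' := scaling_nonneg (α := α) (β := β) hε' ζ
      set s := scaling α β ε ζ with hs_def
      set t := scaling α β ε' ζ with ht_def
      have h1 : |s.1 - t.1| ^ r ≤ dist ε ε' ^ r * gα ζ :=
        hscale _ _ _ hd₁ (by positivity) _ (hgα ζ hζ)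
      have h2 : |s.2 - t.2| ^ r ≤ dist ε ε' ^ r * gβ ζ :=
        hscale _ _ _ hd₂ (by positivity) _ (hgβ ζ hζ)
      have h3 := min_one_add_le_rpow (abs_nonneg (s.1 - t.1)) (abs_nonneg (s.2 - t.2)) hr hr1
      have h4 := hl s t hs hs' ζ hζ
      have h5 := (norm_sub_le _ _).trans (add_le_add (hb s hs ζ hζ) (hb t hs' ζ hζ))
      -- The minimum of the uniform and the Lipschitz bound is what `min_one_add_le_rpow` turns into
      -- a Hölder bound.
      have h6 : ∀ z : ℝ, z ≤ C * (|s.1 - t.1| + |s.2 - t.2|) → z ≤ C + C →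
          z ≤ 2 * C * min 1 (|s.1 - t.1| + |s.2 - t.2|) := by
        intro z hz hz'
        have hC' : 0 ≤ C * (|s.1 - t.1| + |s.2 - t.2|) := by positivity
        rcases min_choice 1 (|s.1 - t.1| + |s.2 - t.2|) with h | h <;> rw [h] <;> linarith
      refine (h6 _ h4 h5).trans ?_
      rw [mul_assoc (2 * C)]
      refine mul_le_mul_of_nonneg_left (h3.trans ?_) (by positivity)
      linarith
    · have h0 : ∀ s, torusAverage N (fun j => (m j : ℤ)) (amplitude h₁ h₂ Φ Ψ φ s) ζ = 0 :=
        fun s => torusAverage_amplitude_eq_zero (fun ζ h => hR ζ h.le) _ s (not_le.1 hζ)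
      rw [h0, h0, sub_self, norm_zero]
      exact mul_nonneg (by positivity) (add_nonneg (gα_nonneg ζ) (gβ_nonneg ζ))

end Amplitude

/-! ### The regularized integral -/

section Regularized

variable {n : ℕ}

/-- The function `s ↦ χ (1 / s)`, the expression of `χ` in the chart at infinity. -/
noncomputable def chartAtInfinity (χ : ℝ≥0∞ → ℂ) (s : ℝ) : ℂ :=
  χ (ENNReal.ofReal s)⁻¹

lemma SmoothOnExtended.smoothPair {χ : ℝ≥0∞ → ℂ} (hχ : SmoothOnExtended χ) :
    SmoothPair (chartAtInfinity χ) fun t => χ (ENNReal.ofReal t) where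
  left := hχ.2
  right := hχ.1
  glue s hs := by rw [chartAtInfinity, ENNReal.ofReal_inv_of_pos hs]

lemma smoothPair_one : SmoothPair (fun _ => 1) fun _ => 1 where
  left := contDiffOn_const
  right := contDiffOn_const
  glue _ _ := rfl

lemma chartCutoff_zero (χ : ℝ≥0∞ → ℂ) (Φ : (Fin n → ℂ) → ℝ) (ζ : Fin n → ℂ) :
    chartCutoff (chartAtInfinity χ) Φ 0 ζ = χ ⊤ := by
  simp [chartCutoff, chartAtInfinity]

lemma chartCutoff_one (Φ : (Fin n → ℂ) → ℝ) (s : ℝ) (ζ : Fin n → ℂ) :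
    chartCutoff (fun _ => 1) Φ s ζ = 1 := rfl

lemma chartCutoff_eq_cutoff (χ : ℝ≥0∞ → ℂ) {Φ : (Fin n → ℂ) → ℝ} (hΦ : ∀ ζ, 0 < Φ ζ)
    (α : Fin n → ℕ) {ε : ℝ} (hε : 0 < ε) {ζ : Fin n → ℂ} (hζ : ∀ j, ζ j ≠ 0) :
    chartCutoff (chartAtInfinity χ) Φ (ε / ‖cMonomial α ζ‖ ^ 2) ζ = cutoff χ Φ α ε ζ := by
  have hm : 0 < ‖cMonomial α ζ‖ := norm_pos_iff.2 (cMonomial_ne_zero α hζ)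
  have hp := hΦ ζ
  rw [chartCutoff, chartAtInfinity, cutoff, ← ENNReal.ofReal_inv_of_pos (by positivity)]
  congr 2
  field_simp

/-- A function vanishing to order `k` at `0` is `O(t ^ k)` on bounded intervals. -/
lemma exists_norm_le_mul_pow {χ : ℝ≥0∞ → ℂ} (hχ : SmoothOnExtended χ) {k : ℕ}
    (hk : VanishesToOrderAtZero χ k) {T : ℝ} (hT : 0 < T) :
    ∃ C, 0 ≤ C ∧ ∀ t ∈ Icc 0 T, ‖χ (ENNReal.ofReal t)‖ ≤ C * t ^ k := by
  set f : ℝ → ℂ := fun t => χ (ENNReal.ofReal t) with hf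
  have hsm : ContDiffOn ℝ ∞ f (Icc 0 T) := hχ.1.mono fun t ht => ht.1
  cases k with
  | zero =>
    obtain ⟨C, hC⟩ := isCompact_Icc.exists_bound_of_continuousOn hsm.continuousOn
    refine ⟨C, (norm_nonneg _).trans (hC 0 ⟨le_rfl, hT.le⟩), fun t ht => ?_⟩
    simpa using hC t ht
  | succ k =>
    obtain ⟨C, hC⟩ := isCompact_Icc.exists_bound_of_continuousOn
      (hsm.continuousOn_iteratedDerivWithin (m := k + 1) (by exact_mod_cast le_top)
        (uniqueDiffOn_Icc hT))
    have hC0 : 0 ≤ C := (norm_nonneg _).trans (hC 0 ⟨le_rfl, hT.le⟩)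
    refine ⟨C / k.factorial, by positivity, fun t ht => ?_⟩
    have h := taylor_mean_remainder_bound hT.le (hsm.of_le (by exact_mod_cast le_top)) ht hC
    have h0 : taylorWithinEval f k (Icc 0 T) 0 t = 0 := by
      rw [taylor_within_apply]
      refine Finset.sum_eq_zero fun j hj => ?_
      have hset : Icc (0 : ℝ) T =ᶠ[𝓝 0] Ici 0 := by
        filter_upwards [gt_mem_nhds hT] with x hx
        exact propext ⟨fun h => h.1, fun h => ⟨h, hx.le⟩⟩
      rw [iteratedDerivWithin, iteratedFDerivWithin_congr_set hset, ← iteratedDerivWithin,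
        hk j (by simpa using hj), smul_zero]
    rw [h0, sub_zero, sub_zero] at h
    rwa [div_mul_eq_mul_div]

lemma continuous_cutoff {χ : ℝ≥0∞ → ℂ} (hχ : SmoothOnExtended χ) {Φ : (Fin n → ℂ) → ℝ}
    (hΦ : Continuous Φ) (α : Fin n → ℕ) (ε : ℝ) : Continuous (cutoff χ Φ α ε) := by
  have heq : cutoff χ Φ α ε = fun ζ =>
      χ (ENNReal.ofReal (max (Φ ζ * ‖cMonomial α ζ‖ ^ 2 / ε) 0)) := by
    funext ζ
    rw [cutoff]
    congr 1
    simp [ENNReal.ofReal, Real.toNNReal]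
  rw [heq]
  exact (continuous_comp_max hχ.1).comp
    ((hΦ.mul ((continuous_cMonomial α).norm.pow 2)).div_const ε)

/-- The cutoff function compensates the pole of `ζ ^ (-k α)`, since `χ` vanishes to order `k`. -/
lemma exists_bound_cutoff_div {χ : ℝ≥0∞ → ℂ} (hχ : SmoothOnExtended χ) {k : ℕ}
    (hk : VanishesToOrderAtZero χ k) {Φ : (Fin n → ℂ) → ℝ} (hΦ : Continuous Φ)
    (hΦpos : ∀ ζ, 0 < Φ ζ) (α : Fin n → ℕ) {ε : ℝ} (hε : 0 < ε) (R : ℝ) :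
    ∃ C, ∀ ζ, ‖ζ‖ ≤ R → ‖cutoff χ Φ α ε ζ / cMonomial (k • α) ζ‖ ≤ C := by
  obtain ⟨P, hP⟩ := (isCompact_closedBall (0 : Fin n → ℂ) R).exists_bound_of_continuousOn
    hΦ.continuousOn
  obtain ⟨Q, hQ⟩ := (isCompact_closedBall (0 : Fin n → ℂ) R).exists_bound_of_continuousOn
    (continuous_cMonomial α).continuousOn
  have hT : 0 < |P| * |Q| ^ 2 / ε + 1 := by positivity
  obtain ⟨C, hC, hCb⟩ := exists_norm_le_mul_pow hχ hk hT
  refine ⟨C * (|P| / ε) ^ k * |Q| ^ k, fun ζ hζ => ?_⟩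
  have hζ' : ζ ∈ Metric.closedBall (0 : Fin n → ℂ) R := by simpa using hζ
  have hp : Φ ζ ≤ |P| := (le_abs_self _).trans ((hP ζ hζ').trans (le_abs_self P))
  have hq : ‖cMonomial α ζ‖ ≤ |Q| := (hQ ζ hζ').trans (le_abs_self Q)
  have hp0 := hΦpos ζ
  set a := ‖cMonomial α ζ‖ with ha
  have ha0 : 0 ≤ a := norm_nonneg _
  have ht : Φ ζ * a ^ 2 / ε ∈ Icc 0 (|P| * |Q| ^ 2 / ε + 1) := by
    refine ⟨by positivity, le_trans ?_ (le_add_of_nonneg_right zero_le_one)⟩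
    gcongr
  have h := hCb _ ht
  rw [norm_div, cMonomial_smul, norm_pow, ← ha]
  refine div_le_of_le_mul₀ (by positivity) (by positivity) (h.trans ?_)
  calc C * (Φ ζ * a ^ 2 / ε) ^ k = C * (Φ ζ / ε) ^ k * a ^ k * a ^ k := by
        rw [mul_div_right_comm, mul_pow, ← pow_mul, two_mul, pow_add]; ring
    _ ≤ C * (|P| / ε) ^ k * |Q| ^ k * a ^ k := by gcongr

variable {χ₁ χ₂ : ℝ≥0∞ → ℂ} {Φ Ψ : (Fin n → ℂ) → ℝ} {φ : (Fin n → ℂ) → ℂ} {α β : Fin n → ℕ}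
  {k ℓ : ℕ}

lemma aestronglyMeasurable_cutoff_div (hχ : SmoothOnExtended χ₁) (hΦ : Continuous Φ) (ε : ℝ)
    (m : Fin n → ℕ) : AEStronglyMeasurable fun ζ => cutoff χ₁ Φ α ε ζ / cMonomial m ζ :=
  (continuous_cutoff hχ hΦ α ε).aestronglyMeasurable.div₀
    (continuous_cMonomial m).aestronglyMeasurable

lemma integrable_cutoff_div_mul (hχ : SmoothOnExtended χ₁) (hk : VanishesToOrderAtZero χ₁ k)
    (hΦ : Continuous Φ) (hΦpos : ∀ ζ, 0 < Φ ζ) (hφ : Integrable φ) (hφc : HasCompactSupport φ)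
    {ε : ℝ} (hε : 0 < ε) :
    Integrable fun ζ => cutoff χ₁ Φ α ε ζ / cMonomial (k • α) ζ * φ ζ := by
  obtain ⟨R, -, hR⟩ := hφc.exists_pos_le_norm
  obtain ⟨C, hC⟩ := exists_bound_cutoff_div hχ hk hΦ hΦpos α hε R
  refine (hφ.norm.const_mul C).mono'
    ((aestronglyMeasurable_cutoff_div hχ hΦ ε _).mul hφ.aestronglyMeasurable)
    (.of_forall fun ζ => ?_)
  rw [norm_mul]
  rcases le_total ‖ζ‖ R with h | h
  · exact mul_le_mul_of_nonneg_right (hC ζ h) (norm_nonneg _)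
  · simp [hR ζ h]

lemma integrable_regIntegrand (hχ₁ : SmoothOnExtended χ₁) (hχ₂ : SmoothOnExtended χ₂)
    (hk : VanishesToOrderAtZero χ₁ k) (hℓ : VanishesToOrderAtZero χ₂ ℓ)
    (hΦ : Continuous Φ) (hΦpos : ∀ ζ, 0 < Φ ζ) (hΨ : Continuous Ψ) (hΨpos : ∀ ζ, 0 < Ψ ζ)
    (hφ : Integrable φ) (hφc : HasCompactSupport φ) {ε : ℝ × ℝ} (hε₁ : 0 < ε.1) (hε₂ : 0 < ε.2) :
    Integrable (regIntegrand χ₁ χ₂ Φ Ψ α β k ℓ φ ε) := by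
  have h := integrable_cutoff_div_mul (α := β) hχ₂ hℓ hΨ hΨpos hφ hφc hε₂
  refine (integrable_cutoff_div_mul (α := α) hχ₁ hk hΦ hΦpos h hφc.mul_left hε₁).congr
    (.of_forall fun ζ => ?_)
  simp only [regIntegrand, cMonomial_add]
  ring

/-- On the open quadrant, the regularized integral is an averaged integral. -/
lemma integral_regIntegrand_eq {N : ℕ} [NeZero N] (hχ₁ : SmoothOnExtended χ₁)
    (hχ₂ : SmoothOnExtended χ₂) (hk : VanishesToOrderAtZero χ₁ k)
    (hℓ : VanishesToOrderAtZero χ₂ ℓ) (hΦ : Continuous Φ) (hΦpos : ∀ ζ, 0 < Φ ζ)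
    (hΨ : Continuous Ψ) (hΨpos : ∀ ζ, 0 < Ψ ζ) (hφ : Integrable φ) (hφc : HasCompactSupport φ)
    {ε : ℝ × ℝ} (hε₁ : 0 < ε.1) (hε₂ : 0 < ε.2) :
    ∫ ζ, regIntegrand χ₁ χ₂ Φ Ψ α β k ℓ φ ε ζ =
      averagedIntegral N (k • α + ℓ • β) (regNumerator (chartAtInfinity χ₁) (chartAtInfinity χ₂)
        Φ Ψ α β φ ε) := by
  have hae : regIntegrand χ₁ χ₂ Φ Ψ α β k ℓ φ ε =ᵐ[volume] fun ζ =>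
      regNumerator (chartAtInfinity χ₁) (chartAtInfinity χ₂) Φ Ψ α β φ ε ζ /
        cMonomial (k • α + ℓ • β) ζ := by
    filter_upwards [ae_forall_apply_ne_zero] with ζ hζ
    simp only [regNumerator, amplitude, scaling, chartCutoff_eq_cutoff _ hΦpos α hε₁ hζ,
      chartCutoff_eq_cutoff _ hΨpos β hε₂ hζ, regIntegrand]
    ring
  rw [averagedIntegral_eq_integral _ ((integrable_regIntegrand hχ₁ hχ₂ hk hℓ hΦ hΦpos hΨ hΨpos hφ
    hφc hε₁ hε₂).congr hae), integral_congr_ae hae]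

lemma principalValue_eq_of_tendsto {m : Fin n → ℕ} {ψ : (Fin n → ℂ) → ℂ} {L : ℂ}
    (h : Tendsto (truncatedIntegral m ψ) (𝓝[>] 0) (𝓝 L)) : principalValue m ψ = L :=
  h.limUnder_eq

lemma holderOnWith_of_dist_le {X Y : Type*} [PseudoMetricSpace X] [PseudoMetricSpace Y]
    {f : X → Y} {s : Set X} {C : ℝ} {r : ℝ≥0} (hC : 0 ≤ C)
    (h : ∀ x ∈ s, ∀ y ∈ s, dist (f x) (f y) ≤ C * dist x y ^ (r : ℝ)) :
    HolderOnWith C.toNNReal r f s := by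
  intro x hx y hy
  rw [edist_dist, edist_dist, ENNReal.ofReal_rpow_of_nonneg dist_nonneg (NNReal.coe_nonneg r)]
  refine (ENNReal.ofReal_le_ofReal (h x hx y hy)).trans ?_
  rw [ENNReal.ofReal_mul hC]
  rfl

lemma le_multiindexLength (m : Fin n → ℕ) (j : Fin n) : (m j : ℝ) ≤ multiindexLength m :=
  Real.le_sqrt_of_sq_le
    (Finset.single_le_sum (f := fun j => (m j : ℝ) ^ 2) (fun _ _ => sq_nonneg _)
      (Finset.mem_univ j))

/-- For `2 r < 1 / |m|` the function `|ζ ^ m| ^ (-2 r)` is locally integrable in each variable, of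
real dimension `2`, because no exponent `m j` exceeds the Euclidean length `|m|`. -/
lemma mul_lt_of_lt_inv_multiindexLength {m : Fin n → ℕ} {r : ℝ≥0}
    (h : 2 * (r : ℝ≥0∞) < (ENNReal.ofReal (multiindexLength m))⁻¹) (j : Fin n) :
    2 * ((r : ℝ) * m j) < 2 := by
  have hle := le_multiindexLength m j
  have hL : 0 ≤ multiindexLength m := Real.sqrt_nonneg _
  rcases hL.eq_or_lt with h0 | h0
  · have : (m j : ℝ) = 0 := le_antisymm (hle.trans h0.ge) (Nat.cast_nonneg _)
    rw [this]; norm_num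
  · rw [← ENNReal.ofReal_inv_of_pos h0, ← ENNReal.ofReal_coe_nnreal,
      show (2 : ℝ≥0∞) = ENNReal.ofReal 2 by simp, ← ENNReal.ofReal_mul (by norm_num),
      ENNReal.ofReal_lt_ofReal_iff (inv_pos.2 h0), ← one_div, lt_div_iff₀ h0] at h
    have := mul_le_mul_of_nonneg_left hle (mul_nonneg zero_le_two (NNReal.coe_nonneg r))
    linarith

lemma exists_exponent (α β : Fin n → ℕ) :
    ∃ r : ℝ≥0, 0 < r ∧ r ≤ 1 ∧ 2 * (r : ℝ≥0∞) < min (ENNReal.ofReal (multiindexLength α))⁻¹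
      (ENNReal.ofReal (multiindexLength β))⁻¹ := by
  have hpos : 0 < min 2 (min (ENNReal.ofReal (multiindexLength α))⁻¹
      (ENNReal.ofReal (multiindexLength β))⁻¹) := by
    simp [ENNReal.inv_pos]
  obtain ⟨q, hq0, hq⟩ := ENNReal.lt_iff_exists_nnreal_btwn.1 hpos
  have hq2 : q < 2 := by exact_mod_cast hq.trans_le (min_le_left _ _)
  refine ⟨q / 2, half_pos (by exact_mod_cast hq0), ?_, ?_⟩
  · exact (div_le_one two_pos).2 hq2.le
  · have : (2 : ℝ≥0∞) * ((q / 2 : ℝ≥0) : ℝ≥0∞) = q := by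
      exact_mod_cast congrArg ((↑) : ℝ≥0 → ℝ≥0∞) (mul_div_cancel₀ q (two_ne_zero))
    rw [this]
    exact hq.trans_le (min_le_right _ _)

end Regularized

theorem mainTheorem8 {n : ℕ} (α β : Fin n → ℕ) (k ℓ : ℕ)
    (Φ Ψ : (Fin n → ℂ) → ℝ)
    (hΦ : ContDiff ℝ ∞ Φ) (hΦpos : ∀ ζ, 0 < Φ ζ)
    (hΨ : ContDiff ℝ ∞ Ψ) (hΨpos : ∀ ζ, 0 < Ψ ζ)
    (χ₁ χ₂ : ℝ≥0∞ → ℂ)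
    (hχ₁ : SmoothOnExtended χ₁) (hχ₂ : SmoothOnExtended χ₂)
    (hk : VanishesToOrderAtZero χ₁ k) (hℓ : VanishesToOrderAtZero χ₂ ℓ)
    (hχ₁_top : χ₁ ⊤ = 1)
    (φ : (Fin n → ℂ) → ℂ) (hφ : ContDiff ℝ ∞ φ) (hφc : HasCompactSupport φ) :
    -- the integrals and the principal values that occur below are meaningful
    (∀ ε₁ ε₂ : ℝ, 0 < ε₁ → 0 < ε₂ →
      Integrable (regIntegrand χ₁ χ₂ Φ Ψ α β k ℓ φ (ε₁, ε₂))) ∧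
    PrincipalValueExists (k • α + ℓ • β) φ ∧
    (∀ ε₁ : ℝ, 0 < ε₁ → PrincipalValueExists (ℓ • β)
      (fun ζ => cutoff χ₁ Φ α ε₁ ζ / cMonomial (k • α) ζ * φ ζ)) ∧
    (∀ ε₂ : ℝ, 0 < ε₂ → PrincipalValueExists (k • α)
      (fun ζ => cutoff χ₂ Ψ β ε₂ ζ / cMonomial (ℓ • β) ζ * φ ζ)) ∧
    -- the limit, as the two positive parameters tend to zero independently
    (χ₂ ⊤ = 1 →
      Tendsto (fun ε : ℝ × ℝ => ∫ ζ, regIntegrand χ₁ χ₂ Φ Ψ α β k ℓ φ ε ζ)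
        (𝓝[>] 0 ×ˢ 𝓝[>] 0) (𝓝 (principalValue (k • α + ℓ • β) φ))) ∧
    (χ₂ ⊤ = 0 →
      Tendsto (fun ε : ℝ × ℝ => ∫ ζ, regIntegrand χ₁ χ₂ Φ Ψ α β k ℓ φ ε ζ)
        (𝓝[>] 0 ×ˢ 𝓝[>] 0) (𝓝 0)) ∧
    -- Hölder continuity on the closed quadrant
    (∀ r : ℝ≥0, 0 < r → r ≤ 1 →
      2 * (r : ℝ≥0∞) < min (ENNReal.ofReal (multiindexLength α))⁻¹
        (ENNReal.ofReal (multiindexLength β))⁻¹ →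
      ∃ C : ℝ≥0, HolderOnWith C r (regIntegral χ₁ χ₂ Φ Ψ α β k ℓ φ) (Ici 0 ×ˢ Ici 0)) := by
  set m : Fin n → ℕ := k • α + ℓ • β with hm
  -- Each of the at most `m j` derivatives in `ζ j` changes the weight `m j` by one, so that
  -- `2 * m j ≤ N` keeps the weights that have to be nontrivial strictly between `0` and `N`.
  obtain ⟨N, hN0, hN⟩ : ∃ N : ℕ, N ≠ 0 ∧ ∀ j, 2 * m j ≤ N :=
    ⟨2 * ∑ j, m j + 1, by omega, fun j => by
      have := Finset.single_le_sum (f := m) (fun _ _ => Nat.zero_le _) (Finset.mem_univ j)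
      omega⟩
  have : NeZero N := ⟨hN0⟩
  have H₁ := hχ₁.smoothPair
  have H₂ := hχ₂.smoothPair
  have H₀ := smoothPair_one
  have hφi : Integrable φ := hφ.continuous.integrable_of_hasCompactSupport hφc
  set A := fun (h₁ h₂ : ℝ → ℂ) (ε : ℝ × ℝ) =>
    averagedIntegral N m (regNumerator h₁ h₂ Φ Ψ α β φ ε) with hA
  have hopen : ∀ ε : ℝ × ℝ, 0 < ε.1 → 0 < ε.2 →
      ∫ ζ, regIntegrand χ₁ χ₂ Φ Ψ α β k ℓ φ ε ζ =
        A (chartAtInfinity χ₁) (chartAtInfinity χ₂) ε := fun ε h₁ h₂ =>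
    integral_regIntegrand_eq hχ₁ hχ₂ hk hℓ hΦ.continuous hΦpos hΨ.continuous hΨpos hφi hφc h₁ h₂
  have hpv : Tendsto (truncatedIntegral m φ) (𝓝[>] 0) (𝓝 (A (fun _ => 1) (fun _ => 1) (0, 0))) := by
    refine tendsto_truncatedIntegral m m hφi (.of_forall fun ζ => ?_)
      (integrable_torusAverage_regNumerator H₀ H₀ hΦ hΦpos hΨ hΨpos hφ hφc m hN ⟨le_rfl, le_rfl⟩)
    simp [regNumerator, amplitude, chartCutoff]
  have hpv₁ : ∀ ε₁ : ℝ, 0 < ε₁ → Tendsto (truncatedIntegral (ℓ • β)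
      (fun ζ => cutoff χ₁ Φ α ε₁ ζ / cMonomial (k • α) ζ * φ ζ)) (𝓝[>] 0)
        (𝓝 (A (chartAtInfinity χ₁) (fun _ => 1) (ε₁, 0))) := by
    intro ε₁ hε
    refine tendsto_truncatedIntegral m (ℓ • β)
      (integrable_cutoff_div_mul hχ₁ hk hΦ.continuous hΦpos hφi hφc hε) ?_
      (integrable_torusAverage_regNumerator H₁ H₀ hΦ hΦpos hΨ hΨpos hφ hφc m hN ⟨hε.le, le_rfl⟩)
    filter_upwards [ae_forall_apply_ne_zero] with ζ hζ
    simp only [regNumerator, amplitude, scaling, chartCutoff_eq_cutoff _ hΦpos α hε hζ, hm,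
      cMonomial_add, chartCutoff_one]
    rw [mul_one, div_mul_eq_mul_div, div_div]
  have hpv₂ : ∀ ε₂ : ℝ, 0 < ε₂ → Tendsto (truncatedIntegral (k • α)
      (fun ζ => cutoff χ₂ Ψ β ε₂ ζ / cMonomial (ℓ • β) ζ * φ ζ)) (𝓝[>] 0)
        (𝓝 (A (fun _ => 1) (chartAtInfinity χ₂) (0, ε₂))) := by
    intro ε₂ hε
    refine tendsto_truncatedIntegral m (k • α)
      (integrable_cutoff_div_mul hχ₂ hℓ hΨ.continuous hΨpos hφi hφc hε) ?_
      (integrable_torusAverage_regNumerator H₀ H₂ hΦ hΦpos hΨ hΨpos hφ hφc m hN ⟨le_rfl, hε.le⟩)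
    filter_upwards [ae_forall_apply_ne_zero] with ζ hζ
    simp only [regNumerator, amplitude, scaling, chartCutoff_eq_cutoff _ hΨpos β hε hζ, hm,
      cMonomial_add, chartCutoff_one]
    rw [one_mul, div_mul_eq_mul_div, div_div, mul_comm (cMonomial (ℓ • β) ζ)]
  -- On an axis the corresponding cutoff function is the constant `χ ⊤`.
  have hreg : ∀ ε : ℝ × ℝ, 0 ≤ ε.1 ∧ 0 ≤ ε.2 → regIntegral χ₁ χ₂ Φ Ψ α β k ℓ φ ε =
      A (chartAtInfinity χ₁) (chartAtInfinity χ₂) ε := by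
    rintro ⟨ε₁, ε₂⟩ ⟨h₁, h₂⟩
    simp only at h₁ h₂
    rcases h₁.eq_or_lt with rfl | h₁ <;> rcases h₂.eq_or_lt with rfl | h₂
    · rw [regIntegral, if_neg (lt_irrefl _), if_neg (lt_irrefl _),
        principalValue_eq_of_tendsto hpv]
      simp only [hA]
      rw [← averagedIntegral_const_mul]
      congr 1
      funext ζ
      simp only [regNumerator, amplitude, scaling, zero_div, chartCutoff_zero]
      simp [chartCutoff_one]
    · rw [regIntegral, if_neg (lt_irrefl _), if_pos h₂,
        principalValue_eq_of_tendsto (hpv₂ ε₂ h₂)]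
      simp only [hA]
      rw [← averagedIntegral_const_mul]
      congr 1
      funext ζ
      simp only [regNumerator, amplitude, scaling, zero_div, chartCutoff_zero]
      simp [chartCutoff_one, mul_assoc]
    · rw [regIntegral, if_pos h₁, if_neg (lt_irrefl _),
        principalValue_eq_of_tendsto (hpv₁ ε₁ h₁)]
      simp only [hA]
      rw [← averagedIntegral_const_mul]
      congr 1
      funext ζ
      simp only [regNumerator, amplitude, scaling, zero_div, chartCutoff_zero]
      simp [chartCutoff_one]
      ring
    · rw [regIntegral, if_pos h₁, if_pos h₂, hopen _ h₁ h₂]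
  have hholder : ∀ r : ℝ≥0, 0 < r → r ≤ 1 →
      2 * (r : ℝ≥0∞) < min (ENNReal.ofReal (multiindexLength α))⁻¹
        (ENNReal.ofReal (multiindexLength β))⁻¹ →
      ∃ C : ℝ≥0, HolderOnWith C r (regIntegral χ₁ χ₂ Φ Ψ α β k ℓ φ) (Ici 0 ×ˢ Ici 0) := by
    intro r hr hr1 hlt
    obtain ⟨C, hC, hCb⟩ := exists_averagedIntegral_sub_le (N := N) (α := α) (β := β) H₁ H₂ hΦ hΦpos
      hΨ hΨpos hφ hφc m hN (NNReal.coe_nonneg r) (by exact_mod_cast hr1)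
      (mul_lt_of_lt_inv_multiindexLength (hlt.trans_le (min_le_left _ _)))
      (mul_lt_of_lt_inv_multiindexLength (hlt.trans_le (min_le_right _ _)))
    refine ⟨C.toNNReal, holderOnWith_of_dist_le hC fun x hx y hy => ?_⟩
    have hx' : 0 ≤ x.1 ∧ 0 ≤ x.2 := hx
    have hy' : 0 ≤ y.1 ∧ 0 ≤ y.2 := hy
    rw [hreg x hx', hreg y hy', dist_eq_norm]
    exact hCb x y hx' hy'
  have hlim : Tendsto (fun ε : ℝ × ℝ => ∫ ζ, regIntegrand χ₁ χ₂ Φ Ψ α β k ℓ φ ε ζ)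
      (𝓝[>] 0 ×ˢ 𝓝[>] 0) (𝓝 (χ₂ ⊤ * principalValue m φ)) := by
    obtain ⟨r, hr, hr1, hlt⟩ := exists_exponent α β
    obtain ⟨C, hC⟩ := hholder r hr hr1 hlt
    have h0 : ((0 : ℝ), (0 : ℝ)) ∈ Ici (0 : ℝ) ×ˢ Ici (0 : ℝ) :=
      ⟨self_mem_Ici, self_mem_Ici⟩
    have hcont := (hC.continuousOn hr) (0, 0) h0
    have hval : regIntegral χ₁ χ₂ Φ Ψ α β k ℓ φ (0, 0) = χ₂ ⊤ * principalValue m φ := by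
      rw [regIntegral, if_neg (lt_irrefl _), if_neg (lt_irrefl _), hχ₁_top, one_mul]
    rw [ContinuousWithinAt, hval] at hcont
    have hle : (𝓝[>] (0 : ℝ) ×ˢ 𝓝[>] (0 : ℝ)) ≤ 𝓝[Ici 0 ×ˢ Ici 0] ((0 : ℝ), (0 : ℝ)) := by
      rw [nhdsWithin_prod_eq]
      exact Filter.prod_mono (nhdsWithin_mono _ Ioi_subset_Ici_self)
        (nhdsWithin_mono _ Ioi_subset_Ici_self)
    refine (hcont.mono_left hle).congr' ?_
    filter_upwards [prod_mem_prod (self_mem_nhdsWithin (a := (0 : ℝ)) (s := Ioi 0))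
      (self_mem_nhdsWithin (a := (0 : ℝ)) (s := Ioi 0))] with ε hε
    have h₁ : 0 < ε.1 := hε.1
    have h₂ : 0 < ε.2 := hε.2
    rw [regIntegral, if_pos h₁, if_pos h₂]
  refine ⟨fun ε₁ ε₂ h₁ h₂ => integrable_regIntegrand hχ₁ hχ₂ hk hℓ hΦ.continuous hΦpos
      hΨ.continuous hΨpos hφi hφc h₁ h₂, ⟨_, hpv⟩, fun ε₁ h => ⟨_, hpv₁ ε₁ h⟩,
    fun ε₂ h => ⟨_, hpv₂ ε₂ h⟩, fun h => ?_, fun h => ?_, hholder⟩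
  · rw [h, one_mul] at hlim
    exact hlim
  · rw [h, zero_mul] at hlim
    exact hlim
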